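/- All graphs are finite and simple. For a graph $G$ and $S\subseteq V(G)$, let $N_G(S)$ be the set of vertices outside $S$ that have a neighbour in $S$, and let $G[S]$ be the subgraph induced by $S$. For a real $C>0$, a graph $G$ on $n\ge 3$ vertices is a $C$-expander if (a) $|N_G(S)|\ge C|S|$ for every $S\subseteq V(G)$ with $|S|<n/(2C)$, and (b) there is an edge between any two disjoint sets $S,T\subseteq V(G)$ with $|S|,|T|\ge n/(2C)$. A graph $H$ with disjoint sets $A,B\subseteq V(H)$ of equal size is an $(A,B)$-linking structure if for every bijection $\varphi:A\to B$ there are $|A|$ vertex-disjoint paths in $H$, all of the same length, which together cover all vertices of $H$ and each of which has endpoints $a$ and $\varphi(a)$ for some $a\in A$. A linear forest is a collection of vertex-disjoint paths; the size of a path is its number of vertices. Let $C>10^{15}$. There is $n_0=n_0(C)$ such that the following holds for every $n\ge n_0$, where $n^{0.9}$ and $n^{0.1}/5$ stand for these numbers rounded up or down to an integer (either rounding may be chosen for each of them). If $G$ is a $C$-expander on $n$ vertices, then there are a partition of $V(G)$ into three sets $X,Y,Z$ and disjoint sets $A,B\subseteq X$ such that: 1. $G[X]$ is an $(A,B)$-linking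 structure and $|A|=|B|=n^{0.9}$; 2. $G[Y\cup A\cup B]$ has a spanning linear forest consisting of $|A|=|B|$ paths, each of size $n^{0.1}/5$, whose endpoints all lie in $A\cup B$; 3. $G[Z]$ and $G[Z\cup Y\cup A\cup B]$ are both $(C/100)$-expanders. -/

import Mathlib

namespace ExpanderPartition

universe u

/-- The outer neighbourhood `N_G(S)`: the vertices outside `S` with a neighbour in `S`. -/
def outerNeighbors {V : Type u} (G : SimpleGraph V) (S : Set V) : Set V :=
  {v | v ∉ S ∧ ∃ s ∈ S, G.Adj s v}

/-- `C`-expanders. As `Nat.card` is `0` on infinite types, the first clause also forces the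
vertex set to be finite. -/
def IsExpander {V : Type u} (G : SimpleGraph V) (C : ℝ) : Prop :=
  3 ≤ Nat.card V ∧
  (∀ S : Set V, (S.ncard : ℝ) < (Nat.card V : ℝ) / (2 * C) →
    C * (S.ncard : ℝ) ≤ ((outerNeighbors G S).ncard : ℝ)) ∧
  (∀ S T : Set V, Disjoint S T →
    (Nat.card V : ℝ) / (2 * C) ≤ (S.ncard : ℝ) →
    (Nat.card V : ℝ) / (2 * C) ≤ (T.ncard : ℝ) →
    ∃ s ∈ S, ∃ t ∈ T, G.Adj s t)

/-- `(A, B)`-linking structures. Being vertex disjoint, the `|A|` paths are indexed by the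
vertex of `A` at which they start. -/
def IsLinkingStructure {V : Type u} (H : SimpleGraph V) (A B : Set V) : Prop :=
  Disjoint A B ∧ A.ncard = B.ncard ∧
  ∀ φ : A ≃ B, ∃ (ℓ : ℕ) (P : ∀ a : A, H.Walk (a : V) (φ a : V)),
    (∀ a, (P a).IsPath) ∧
    (∀ a, (P a).length = ℓ) ∧
    (∀ a a', a ≠ a' → List.Disjoint (P a).support (P a').support) ∧
    (∀ v : V, ∃ a, v ∈ (P a).support)

/-- A linear forest in `G` with `t` paths: a collection of `t` vertex disjoint paths of `G`. -/
structure LinearForest {V : Type u} (G : SimpleGraph V) (t : ℕ) where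
  first : Fin t → V
  last : Fin t → V
  path : ∀ i, G.Walk (first i) (last i)
  isPath : ∀ i, (path i).IsPath
  disjoint : ∀ i j, i ≠ j → List.Disjoint (path i).support (path j).support

namespace LinearForest

variable {V : Type u} {G : SimpleGraph V} {t : ℕ}

/-- The forest covers all vertices of `G`. -/
def IsSpanning (F : LinearForest G t) : Prop :=
  ∀ v : V, ∃ i, v ∈ (F.path i).support

/-- The set of endpoints of the paths. -/
def ends (F : LinearForest G t) : Set V :=
  {v | ∃ i, v = F.first i ∨ v = F.last i}

/-- The size (number of vertices) of the `i`-th path. -/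
def size (F : LinearForest G t) (i : Fin t) : ℕ :=
  (F.path i).support.length

end LinearForest

/-- `k` is the real number `x` rounded down or up. -/
def IsRounding (x : ℝ) (k : ℕ) : Prop :=
  k = ⌊x⌋₊ ∨ k = ⌈x⌉₊

end ExpanderPartition

namespace ExpanderPartition

open Equiv

/-! ### Rearrangeable switching networks -/

/-! All structures are grown, one vertex at a time, inside an oriented forest `E` that keeps the
invariant `IsExtendable` of Friedman and Pippenger: with `m = ⌈n/(2C)⌉` and `D = ⌊C/50⌋`, every set
of at most `2m` vertices has at least `D` times as many unused neighbours and children as elements.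
While enough room is left, a used vertex with fewer than `D` children can be given a new child
(`IsExtendable.exists_insert`), and branches can be deleted again at no cost
(`IsExtendable.rollback`). Therefore two used vertices with few children can be connected by a path
of any prescribed length that is not too short: grow a binary tree with at least `m` leaves from
each, use an edge between the two sets of leaves, and delete everything off the resulting path
(`IsExtendable.exists_connect`).

The linking structure is a Beneš network. For `N ≤ 2 ^ c` there are `2 * c` layers of involutions
such that every permutation of `N` points arises by activating some of the transpositions in each
layer (`exists_isRearrangeable_fin`). A transposition is modelled by a gadget whose vertex set
splits into two paths of equal length for either of the two pairings of its terminals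
(`IsExtendable.exists_switch`). Stacking the layers (`IsExtendable.exists_network`) gives paths that
cover the same vertices whatever the permutation. With gadgets of size polynomial in `log n`, the
network occupies only `o(n)` vertices. Connecting the two sides of the network by `N` further paths
of size `k` costs about `n/5` more (`exists_linking_forest`).

The expansion of the remainder comes with the invariant: if all vertices have at most 11 children, a
small set has at least `D - 11` times as many unused neighbours as elements, so every vertex set
containing all unused vertices induces an expander (`IsExpander.induce`). Applied to the final
forest this treats `Z`; applied to the forest before the last paths were added, it treats `Z ∪ Y ∪ A
∪ B`. -/

/-- `τ` arises from the layer `μ` by activating some of its switches. -/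
def IsSetting {ι : Type*} (μ τ : Perm ι) : Prop := ∀ i, τ i = i ∨ τ i = μ i

/-- The permutation `σ` is obtained by passing through the layers in order. -/
def Realizes {ι : Type*} : List (Perm ι) → Perm ι → Prop
  | [], σ => σ = 1
  | μ :: ms, σ => ∃ τ ρ, IsSetting μ τ ∧ Realizes ms ρ ∧ σ = ρ * τ

/-- A list of layers through which every permutation can be routed. -/
structure IsRearrangeable {ι : Type*} (ms : List (Perm ι)) : Prop where
  involutive : ∀ μ ∈ ms, ∀ i, μ (μ i) = i
  realizes : ∀ σ, Realizes ms σ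

lemma Realizes.concat {ι : Type*} {ms : List (Perm ι)} {ρ μ τ : Perm ι}
    (h : Realizes ms ρ) (hτ : IsSetting μ τ) : Realizes (ms ++ [μ]) (τ * ρ) := by
  induction ms generalizing ρ with
  | nil =>
    simp only [Realizes] at h
    exact ⟨τ, 1, hτ, rfl, by simp [h]⟩
  | cons μ' ms ih =>
    obtain ⟨τ', ρ', h1, h2, rfl⟩ := h
    exact ⟨τ', τ * ρ', h1, ih h2, by rw [mul_assoc]⟩

lemma Realizes.sumCongr {α β : Type*} : ∀ {ms : List (Perm α)} {ns : List (Perm β)}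
    {σ : Perm α} {ρ : Perm β}, ms.length = ns.length → Realizes ms σ → Realizes ns ρ →
    Realizes (List.zipWith Perm.sumCongr ms ns) (Perm.sumCongr σ ρ)
  | [], [], σ, ρ, _, h1, h2 => by
    simp only [Realizes] at h1 h2
    subst h1 h2
    simp [Realizes]
  | μ :: ms, ν :: ns, σ, ρ, hl, ⟨τ, σ', ha, hb, hc⟩, ⟨τ', ρ', ha', hb', hc'⟩ => by
    refine ⟨Perm.sumCongr τ τ', Perm.sumCongr σ' ρ', ?_,
      Realizes.sumCongr (by simpa using hl) hb hb', ?_⟩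
    · rintro (i | i)
      · rcases ha i with h | h <;> simp [h]
      · rcases ha' i with h | h <;> simp [h]
    · subst hc hc'
      rw [Perm.sumCongr_mul]

lemma Realizes.congr {α β : Type*} (e : α ≃ β) : ∀ {ms : List (Perm α)} {σ : Perm α},
    Realizes ms σ → Realizes (ms.map e.permCongr) (e.permCongr σ)
  | [], σ, h => by
    simp only [Realizes] at h
    subst h
    simp only [List.map_nil, Realizes]
    ext; simp
  | μ :: ms, σ, ⟨τ, ρ, ha, hb, hc⟩ => by
    refine ⟨e.permCongr τ, e.permCongr ρ, ?_, hb.congr e, ?_⟩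
    · intro i
      rcases ha (e.symm i) with h | h <;> simp [h]
    · subst hc; ext; simp

lemma IsRearrangeable.congr {α β : Type*} (e : α ≃ β) {ms : List (Perm α)}
    (h : IsRearrangeable ms) : IsRearrangeable (ms.map e.permCongr) := by
  constructor
  · intro μ hμ i
    obtain ⟨ν, hν, rfl⟩ := List.mem_map.1 hμ
    simp [h.involutive ν hν]
  · intro σ
    have := (h.realizes (e.permCongr.symm σ)).congr e
    rwa [Equiv.apply_symm_apply] at this

/-- Two fixed-point-free involutions admit a common proper 2-colouring. -/
lemma exists_coloring {α : Type*} (μ ν : Perm α) (hμ : ∀ x, μ (μ x) = x) (hν : ∀ x, ν (ν x) = x)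
    (hμ' : ∀ x, μ x ≠ x) (hν' : ∀ x, ν x ≠ x) :
    ∃ c : α → Bool, (∀ x, c (μ x) = !c x) ∧ ∀ x, c (ν x) = !c x := by
  classical
  have hμi : μ⁻¹ = μ := inv_eq_of_mul_eq_one_left (Equiv.ext hμ)
  have hνi : ν⁻¹ = ν := inv_eq_of_mul_eq_one_left (Equiv.ext hν)
  set ρ : Perm α := ν * μ with hρ
  have hconj : μ * ρ * μ⁻¹ = ρ⁻¹ := by
    rw [hρ, mul_inv_rev, hμi, hνi]
    ext x; simp [hμ]
  have hz : ∀ k : ℤ, μ * ρ ^ k = ρ ^ (-k) * μ := by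
    intro k
    have : μ * ρ ^ k * μ⁻¹ = ρ ^ (-k) := by
      rw [← conj_zpow, hconj, inv_zpow, zpow_neg]
    rw [← this]; group
  -- Since `μ` inverts `ρ` by conjugation, `ρ ^ k x = μ x` yields a fixed point halfway between: `ρ
  -- ^ j x` is fixed by `μ` if `k = 2 * j`, and `ρ ^ (j + 1) x` is fixed by `ν` if `k = 2 * j + 1`.
  have hne : ∀ x, ¬ ρ.SameCycle x (μ x) := by
    rintro x ⟨k, hk⟩
    rcases Int.even_or_odd' k with ⟨j, rfl | rfl⟩
    · apply hμ' ((ρ ^ j) x)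
      have := congrArg (fun f : Perm α => f x) (hz j)
      simp only [Perm.mul_apply] at this
      rw [this, ← hk, ← Perm.mul_apply, ← zpow_add]
      congr 2; ring
    · apply hν' ((ρ ^ (j + 1)) x)
      have h2 : ν = ρ * μ := by ext y; simp [hρ, hμ]
      have := congrArg (fun f : Perm α => f x) (hz (j + 1))
      simp only [Perm.mul_apply] at this
      rw [h2, Perm.mul_apply, this, ← hk, ← Perm.mul_apply, ← Perm.mul_apply,
        ← zpow_one_add, ← zpow_add]
      congr 2; ring
  let s : Setoid α := Perm.SameCycle.setoid ρ
  let q : α → Quotient s := fun x => Quotient.mk s x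
  have hq : ∀ x y, q x = q y ↔ ρ.SameCycle x y := fun x y => Quotient.eq (r := s)
  -- Both `μ` and `ν` interchange the same pairs of distinct `ρ`-cycles. An arbitrary linear order
  -- selects one cycle of each pair, and this selection is the colouring.
  let _ : LinearOrder (Quotient s) := linearOrderOfSTO WellOrderingRel
  have hqne : ∀ x, q x ≠ q (μ x) := fun x h => hne x ((hq _ _).1 h)
  have h1 : ∀ x, q (ν x) = q (μ x) := by
    intro x
    rw [hq]
    refine ⟨-1, ?_⟩
    rw [zpow_neg_one, hρ, mul_inv_rev, hμi, hνi]
    simp [hν]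
  have h2 : ∀ x, q (μ (ν x)) = q x := by
    intro x
    rw [← h1 (ν x), hν]
  have key : ∀ x, decide (q (μ x) < q x) = !decide (q x < q (μ x)) := by
    intro x
    rcases lt_trichotomy (q x) (q (μ x)) with h | h | h
    · simp [h, h.not_gt]
    · exact absurd h (hqne x)
    · simp [h, h.not_gt]
  refine ⟨fun x => decide (q x < q (μ x)), fun x => ?_, fun x => ?_⟩
  · simp only [hμ]; exact key x
  · simp only [h1, h2]; exact key x

/-- The involution on `Option α` that agrees with `μ` away from the fixed point `u` of `μ`
and exchanges `u` with the new point. -/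
def closeFixedPoint {α : Type*} [DecidableEq α] (μ : Perm α) (u : α) : Perm (Option α) :=
  swap none (some u) * μ.optionCongr

lemma closeFixedPoint_spec {α : Type*} [DecidableEq α] {μ : Perm α} {u : α}
    (hμ : ∀ x, μ (μ x) = x) (hu : ∀ x, μ x = x ↔ x = u) :
    (∀ x, closeFixedPoint μ u (closeFixedPoint μ u x) = x) ∧
    (∀ x, closeFixedPoint μ u x ≠ x) ∧
    (∀ x ≠ u, closeFixedPoint μ u (some x) = some (μ x)) ∧
    closeFixedPoint μ u none = some u := by
  have h0 : closeFixedPoint μ u none = some u := by simp [closeFixedPoint]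
  have h1 : closeFixedPoint μ u (some u) = none := by
    simp [closeFixedPoint, (hu u).2 rfl]
  have h2 : ∀ x ≠ u, closeFixedPoint μ u (some x) = some (μ x) := by
    intro x hx
    have : μ x ≠ u := fun h => hx (by rw [← hμ x, h]; exact (hu u).2 rfl)
    simp only [closeFixedPoint, Perm.mul_apply, optionCongr_apply, Option.map_some]
    exact swap_apply_of_ne_of_ne (by simp) (by simpa using this)
  refine ⟨?_, ?_, h2, h0⟩
  · rintro (_ | x)
    · rw [h0, h1]
    · by_cases hx : x = u
      · subst hx; rw [h1, h0]
      · have : μ x ≠ u := fun h => hx (by rw [← hμ x, h]; exact (hu u).2 rfl)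
        rw [h2 x hx, h2 _ this, hμ]
  · rintro (_ | x)
    · simp [h0]
    · by_cases hx : x = u
      · subst hx; simp [h1]
      · rw [h2 x hx]; simpa using fun h => hx ((hu x).1 h)

/-- Two involutions with exactly one fixed point each admit a 2-colouring, proper away from the
fixed points, that gives both fixed points the colour `false`. -/
lemma exists_coloring_of_fixedPoint {α : Type*} (μ ν : Perm α) (u v : α)
    (hμ : ∀ x, μ (μ x) = x) (hν : ∀ x, ν (ν x) = x)
    (hu : ∀ x, μ x = x ↔ x = u) (hv : ∀ x, ν x = x ↔ x = v) :
    ∃ c : α → Bool, (∀ x ≠ u, c (μ x) = !c x) ∧ (∀ x ≠ v, c (ν x) = !c x) ∧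
      c u = false ∧ c v = false := by
  classical
  obtain ⟨m1, m2, m3, m4⟩ := closeFixedPoint_spec hμ hu
  obtain ⟨n1, n2, n3, n4⟩ := closeFixedPoint_spec hν hv
  obtain ⟨c, hc, hc'⟩ := exists_coloring _ _ m1 n1 m2 n2
  -- The `xor` normalises the colour of the added point to `true`, so its partners `u` and `v` both
  -- receive `false`.
  refine ⟨fun x => xor (c (some x)) (!c none), ?_, ?_, ?_, ?_⟩
  · intro x hx
    simp [← m3 x hx, hc]
  · intro x hx
    simp [← n3 x hx, hc']
  · simp [← m4, hc]
  · simp [hc', ← n4]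

/-- The setting of the layer `μ` that moves the points of colour `true` into `P`. -/
lemma exists_setting {α : Type*} (μ : Perm α) (hμ : ∀ x, μ (μ x) = x) (P c : α → Bool)
    (hP : ∀ x, μ x ≠ x → P (μ x) = !P x) (hc : ∀ x, μ x ≠ x → c (μ x) = !c x)
    (hPc : ∀ x, μ x = x → P x = c x) :
    ∃ τ : Perm α, IsSetting μ τ ∧ (∀ x, P (τ x) = c x) ∧ ∀ x, τ (τ x) = x := by
  classical
  -- Exactly the pairs on which `P` and `c` disagree are exchanged; both points of a pair disagree
  -- or neither does.
  let f : α → α := fun x => if P x = c x then x else μ x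
  have hf : ∀ x, f (f x) = x := by
    intro x
    by_cases h : P x = c x
    · simp [f, h]
    · have hx : μ x ≠ x := fun hx => h (hPc x hx)
      have : ¬ P (μ x) = c (μ x) := by rw [hP x hx, hc x hx]; simpa using h
      simp [f, h, this, hμ]
  refine ⟨⟨f, f, hf, hf⟩, ?_, ?_, hf⟩
  · intro x
    by_cases h : P x = c x <;> simp [f, h]
  · intro x
    by_cases h : P x = c x
    · simp [f, h]
    · have hx : μ x ≠ x := fun hx => h (hPc x hx)
      simp only [coe_fn_mk, f, if_neg h, hP x hx]
      revert h; cases P x <;> cases c x <;> simp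

/-- Every permutation factors into two settings of the layer `μ` and a permutation that
preserves `P`. -/
lemma exists_factorization {α : Type*} (μ : Perm α) (hμ : ∀ x, μ (μ x) = x) (P : α → Bool)
    (hP : ∀ x, μ x ≠ x → P (μ x) = !P x)
    (hfix : (∀ x, μ x ≠ x) ∨ ∃ u, P u = false ∧ ∀ x, μ x = x ↔ x = u) (σ : Perm α) :
    ∃ τ ρ τ' : Perm α, IsSetting μ τ ∧ IsSetting μ τ' ∧ (∀ x, P (ρ x) = P x) ∧
      σ = τ' * ρ * τ := by
  have hν : ∀ x, (σ⁻¹ * μ * σ) ((σ⁻¹ * μ * σ) x) = x := by intro x; simp [hμ]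
  have hνf : ∀ x, (σ⁻¹ * μ * σ) x = x ↔ μ (σ x) = σ x := by
    intro x; simp only [Perm.mul_apply]; rw [Perm.inv_eq_iff_eq, eq_comm]
  -- The colour of `x` is the half of the network through which the item entering at `x` is routed.
  -- Items sharing a switch at the input (paired by `μ`) or at the output (paired by `σ⁻¹ * μ * σ`)
  -- must use different halves; an unpaired item has no choice.
  obtain ⟨c, hc, hc', hcP, hcP'⟩ : ∃ c : α → Bool, (∀ x, μ x ≠ x → c (μ x) = !c x) ∧
      (∀ x, (σ⁻¹ * μ * σ) x ≠ x → c ((σ⁻¹ * μ * σ) x) = !c x) ∧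
      (∀ x, μ x = x → P x = c x) ∧ (∀ x, μ (σ x) = σ x → P (σ x) = c x) := by
    rcases hfix with h | ⟨u, hPu, hu⟩
    · obtain ⟨c, h1, h2⟩ := exists_coloring μ (σ⁻¹ * μ * σ) hμ hν h
        (fun x hx => h _ ((hνf x).1 hx))
      exact ⟨c, fun x _ => h1 x, fun x _ => h2 x, fun x hx => absurd hx (h x),
        fun x hx => absurd hx (h _)⟩
    · obtain ⟨c, h1, h2, h3, h4⟩ := exists_coloring_of_fixedPoint μ (σ⁻¹ * μ * σ) u (σ⁻¹ u) hμ hν hu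
        (fun x => by rw [hνf, hu, Perm.eq_inv_iff_eq])
      refine ⟨c, fun x hx => h1 x fun h => hx ((hu x).2 h), fun x hx => h2 x fun h => hx ?_, ?_, ?_⟩
      · rw [hνf, hu, h]; simp
      · intro x hx
        rw [(hu x).1 hx, hPu, h3]
      · intro x hx
        have := (hu _).1 hx
        rw [this, hPu, ← h4, ← this]; simp
  obtain ⟨τ, hτ, hτP, hττ⟩ := exists_setting μ hμ P c hP hc hcP
  obtain ⟨τ', hτ', hτP', hττ'⟩ := exists_setting μ hμ P (fun y => c (σ⁻¹ y)) hP
    (fun y hy => by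
      have := hc' (σ⁻¹ y) (fun h => hy (by simpa using (hνf _).1 h))
      simpa using this)
    (fun y hy => by
      have := hcP' (σ⁻¹ y) (by simpa using hy)
      simpa using this)
  refine ⟨τ, τ' * σ * τ, τ', hτ, hτ', ?_, ?_⟩
  · intro z
    simp only [Perm.mul_apply]
    rw [hτP']
    rw [show σ⁻¹ (σ (τ z)) = τ z by simp, ← hτP, hττ]
  · ext x
    simp [hττ', hττ]

/-- The recursive step of the Beneš network. -/
lemma exists_isRearrangeable_sum {β γ : Type*} [Finite β] [Finite γ]
    {ms : List (Perm β)} {ns : List (Perm γ)} (hm : IsRearrangeable ms)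
    (hn : IsRearrangeable ns) (hl : ms.length = ns.length)
    (μ : Perm (β ⊕ γ)) (hμ : ∀ x, μ (μ x) = x)
    (hP : ∀ x, μ x ≠ x → (μ x).isLeft = !x.isLeft)
    (hfix : (∀ x, μ x ≠ x) ∨ ∃ u, u.isLeft = false ∧ ∀ x, μ x = x ↔ x = u) :
    IsRearrangeable (μ :: (List.zipWith Perm.sumCongr ms ns ++ [μ])) := by
  constructor
  · intro κ hκ
    simp only [List.mem_cons, List.mem_append, List.not_mem_nil, or_false] at hκ
    rcases hκ with rfl | hκ | rfl
    · exact hμ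
    · obtain ⟨i, hi, rfl⟩ := List.mem_iff_getElem.1 hκ
      have h1 : i < ms.length := by simp at hi; omega
      have h2 : i < ns.length := by omega
      rw [List.getElem_zipWith]
      rintro (x | x)
      · simp [hm.involutive _ (List.getElem_mem h1)]
      · simp [hn.involutive _ (List.getElem_mem h2)]
    · exact hμ
  · intro σ
    obtain ⟨τ, ρ, τ', h1, h2, h3, rfl⟩ := exists_factorization μ hμ Sum.isLeft hP hfix σ
    obtain ⟨⟨ρ1, ρ2⟩, hρ⟩ := Perm.mem_sumCongrHom_range_of_perm_mapsTo_inl (σ := ρ) (by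
      rintro _ ⟨x, rfl⟩
      have := h3 (Sum.inl x)
      exact Sum.isLeft_iff.1 (by simpa using this) |>.imp fun _ h => h.symm)
    refine ⟨τ, τ' * ρ, h1, ?_, rfl⟩
    rw [← hρ]
    exact ((hm.realizes ρ1).sumCongr hl (hn.realizes ρ2)).concat h2

/-- Beneš recursion: the points are split into two halves, differing in size by at most one, and
each recursion level adds one layer in front and one behind. For odd size, the last point of the
larger half stays fixed in the outer layers. Fixing the number of layers as `2 * c` for all `n ≤ 2 ^
c` lets unequal halves run in parallel. -/
lemma exists_isRearrangeable_fin (c : ℕ) : ∀ n ≤ 2 ^ c, ∃ ms : List (Perm (Fin n)),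
    ms.length = 2 * c ∧ IsRearrangeable ms := by
  induction c with
  | zero =>
    intro n hn
    refine ⟨[], rfl, by simp, fun σ => ?_⟩
    have : Subsingleton (Fin n) := Fin.subsingleton_iff_le_one.2 (by simpa using hn)
    exact Subsingleton.elim _ _
  | succ c ih =>
    intro n hn
    rw [pow_succ] at hn
    rcases Nat.even_or_odd' n with ⟨k, rfl | rfl⟩
    · obtain ⟨ms, hl, hm⟩ := ih k (by omega)
      have := exists_isRearrangeable_sum hm hm rfl (Equiv.sumComm _ _) (by simp)
        (by rintro (x | x) <;> simp) (Or.inl (by rintro (x | x) <;> simp))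
      let e : Fin k ⊕ Fin k ≃ Fin (2 * k) := finSumFinEquiv.trans (finCongr (by omega))
      exact ⟨_, by simp [hl]; omega, this.congr e⟩
    · obtain ⟨ms, hl, hm⟩ := ih k (by omega)
      obtain ⟨ns, hl', hn'⟩ := ih (k + 1) (by omega)
      let f : Fin k ⊕ Fin (k + 1) → Fin k ⊕ Fin (k + 1) :=
        Sum.elim (fun i => Sum.inr i.castSucc)
          (Fin.lastCases (motive := fun _ => Fin k ⊕ Fin (k + 1)) (Sum.inr (Fin.last k)) Sum.inl)
      have h1 : ∀ i, f (Sum.inl i) = Sum.inr i.castSucc := fun i => rfl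
      have h2 : ∀ i : Fin k, f (Sum.inr i.castSucc) = Sum.inl i := fun i => by simp [f]
      have h3 : f (Sum.inr (Fin.last k)) = Sum.inr (Fin.last k) := by simp [f]
      have hf : ∀ x, f (f x) = x := by
        rintro (i | i)
        · rw [h1, h2]
        · induction i using Fin.lastCases with
          | last => rw [h3, h3]
          | cast i => rw [h2, h1]
      have := exists_isRearrangeable_sum hm hn' (hl.trans hl'.symm) ⟨f, f, hf, hf⟩ hf
        (by
          rintro (i | i)
          · simp [h1]
          · induction i using Fin.lastCases with
            | last => simp [h3]
            | cast i => simp [h2])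
        (Or.inr ⟨Sum.inr (Fin.last k), rfl, by
          rintro (i | i)
          · simp [h1]
          · induction i using Fin.lastCases with
            | last => simp [h3]
            | cast i => simp [h2, Fin.ext_iff, i.2.ne]⟩)
      let e : Fin k ⊕ Fin (k + 1) ≃ Fin (2 * k + 1) := finSumFinEquiv.trans (finCongr (by omega))
      exact ⟨_, by simp [hl, hl']; omega, this.congr e⟩

end ExpanderPartition

namespace ExpanderPartition

open Finset
open scoped Classical

variable {V : Type*} {G : SimpleGraph V} {D m : ℕ} {r : V}

/-! ### Extendable oriented forests -/

/-- The vertices occupied by a forest with root `r` and set `E` of (parent, child) pairs. -/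
noncomputable def used (r : V) (E : Finset (V × V)) : Finset V := insert r (E.image Prod.snd)

/-- The number of children of `v`. -/
noncomputable def outdeg (E : Finset (V × V)) (v : V) : ℕ := (E.filter fun e => e.1 = v).card

lemma mem_used {E : Finset (V × V)} {v : V} : v ∈ used r E ↔ v = r ∨ ∃ e ∈ E, e.2 = v := by
  simp [used]

lemma root_mem_used {E : Finset (V × V)} : r ∈ used r E := mem_insert_self _ _

lemma used_insert (E : Finset (V × V)) (x y : V) :
    used r (insert (x, y) E) = insert y (used r E) := by
  simp only [used, image_insert]; rw [insert_comm]

lemma used_mono {E E' : Finset (V × V)} (h : E ⊆ E') : used r E ⊆ used r E' :=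
  insert_subset_insert _ (image_subset_image h)

lemma outdeg_insert {E : Finset (V × V)} {x y : V} (h : (x, y) ∉ E) (v : V) :
    outdeg (insert (x, y) E) v = outdeg E v + if v = x then 1 else 0 := by
  unfold outdeg
  rw [filter_insert]
  by_cases hv : x = v
  · rw [if_pos hv, if_pos hv.symm, card_insert_of_notMem (by simp [h])]
  · simp [hv, Ne.symm hv]

lemma outdeg_union_le (E E' : Finset (V × V)) (v : V) :
    outdeg (E ∪ E') v ≤ outdeg E v + outdeg E' v := by
  unfold outdeg
  rw [filter_union]
  exact card_union_le _ _

lemma notMem_of_notMem_used {E : Finset (V × V)} {x y : V} (hy : y ∉ used r E) : (x, y) ∉ E :=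
  fun h => hy (mem_used.2 (Or.inr ⟨_, h, rfl⟩))

variable [Fintype V]

/-- The vertices with a neighbour in `S`. -/
noncomputable def nbhd (G : SimpleGraph V) (S : Finset V) : Finset V :=
  univ.filter fun v => ∃ s ∈ S, G.Adj s v

/-- `E` is a set of oriented edges in which every vertex has at most one parent, and every set of
at most `2 * m` vertices expands by a factor `D` if one counts neighbours that are not used, and
children. -/
structure IsExtendable (G : SimpleGraph V) (D m : ℕ) (r : V) (E : Finset (V × V)) : Prop where
  adj : ∀ e ∈ E, G.Adj e.1 e.2
  inj : Set.InjOn Prod.snd (E : Set (V × V))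
  root : ∀ e ∈ E, e.2 ≠ r
  parent : ∀ e ∈ E, e.1 ∈ used r E
  expand : ∀ S : Finset V, S.card ≤ 2 * m →
    D * S.card ≤ (nbhd G S \ used r E).card + ∑ v ∈ S, outdeg E v

/-- Any two disjoint sets of `m` vertices are joined by an edge. -/
def IsJoined (G : SimpleGraph V) (m : ℕ) : Prop :=
  ∀ S T : Finset V, Disjoint S T → m ≤ S.card → m ≤ T.card → ∃ s ∈ S, ∃ t ∈ T, G.Adj s t

lemma mem_nbhd {S : Finset V} {v : V} : v ∈ nbhd G S ↔ ∃ s ∈ S, G.Adj s v := by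
  simp [nbhd]

lemma nbhd_mono {S T : Finset V} (h : S ⊆ T) : nbhd G S ⊆ nbhd G T := fun v hv => by
  obtain ⟨s, hs, ha⟩ := mem_nbhd.1 hv
  exact mem_nbhd.2 ⟨s, h hs, ha⟩

lemma nbhd_union (S T : Finset V) : nbhd G (S ∪ T) = nbhd G S ∪ nbhd G T := by
  ext v; simp only [mem_nbhd, mem_union]; grind

/-- For an `m`-subset `S'` of `S`, the vertices outside `S'` with no neighbour in `S'` send no edge
to `S'`, so there are fewer than `m` of them. -/
lemma IsJoined.card_le_nbhd (hG : IsJoined G m) {S : Finset V} (hS : m ≤ S.card) :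
    Fintype.card V ≤ (nbhd G S).card + 2 * m := by
  obtain ⟨S', hS', hc⟩ := exists_subset_card_eq hS
  have hT : (univ \ (S' ∪ nbhd G S')).card < m := by
    by_contra! h
    obtain ⟨s, hs, t, ht, hst⟩ := hG S' _ (by
      rw [Finset.disjoint_left]; intro v hv; simp [hv]) hc.ge h
    simp only [mem_sdiff, mem_univ, true_and, mem_union, not_or] at ht
    exact ht.2 (mem_nbhd.2 ⟨s, hs, hst⟩)
  have h1 := card_le_card_sdiff_add_card (t := S' ∪ nbhd G S') (s := univ)
  have h2 := card_union_le S' (nbhd G S')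
  have h3 := card_le_card (nbhd_mono (G := G) hS')
  rw [card_univ] at h1
  omega

lemma IsExtendable.outdeg_eq_zero {E : Finset (V × V)} (h : IsExtendable G D m r E) {v : V}
    (hv : v ∉ used r E) : outdeg E v = 0 := by
  rw [outdeg, card_eq_zero, filter_eq_empty_iff]
  rintro e he rfl
  exact hv (h.parent e he)

/-- Deleting edges preserves extendability, as long as parents remain used. -/
lemma IsExtendable.rollback {E E' : Finset (V × V)} (h : IsExtendable G D m r E) (hE : E' ⊆ E)
    (hp : ∀ e ∈ E', e.1 ∈ used r E') : IsExtendable G D m r E' := by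
  refine ⟨fun e he => h.adj e (hE he), h.inj.mono (by exact_mod_cast hE),
    fun e he => h.root e (hE he), hp, fun S hS => (h.expand S hS).trans ?_⟩
  -- Deleting the edge from a parent in `S` to its child loses one child, but the child becomes an
  -- unused neighbour of `S`. As children are distinct, gains and losses balance.
  have h1 : ∑ v ∈ S, outdeg E v
      = ∑ v ∈ S, outdeg E' v + ((E \ E').filter fun e => e.1 ∈ S).card := by
    have : ∀ F : Finset (V × V), ∑ v ∈ S, outdeg F v = (F.filter fun e => e.1 ∈ S).card := by
      intro F
      rw [card_eq_sum_card_fiberwise (f := Prod.fst) (t := S) (by intro e he; simp at he; exact he.2)]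
      refine sum_congr rfl fun v hv => ?_
      unfold outdeg
      congr 1; ext e; simp only [mem_filter]; grind
    rw [this, this, ← card_union_of_disjoint, ← filter_union, union_sdiff_of_subset hE]
    exact disjoint_filter_filter disjoint_sdiff
  have h2 : (((E \ E').filter fun e => e.1 ∈ S).image Prod.snd).card
      = ((E \ E').filter fun e => e.1 ∈ S).card := by
    apply card_image_of_injOn
    apply h.inj.mono
    intro e he; simp at he; exact he.1.1
  have h3 : (nbhd G S \ used r E) ∪ (((E \ E').filter fun e => e.1 ∈ S).image Prod.snd) ⊆
      nbhd G S \ used r E' := by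
    intro v hv
    rw [mem_union] at hv
    rcases hv with hv | hv
    · rw [mem_sdiff] at hv ⊢
      exact ⟨hv.1, fun h => hv.2 (used_mono hE h)⟩
    · obtain ⟨e, he, rfl⟩ := mem_image.1 hv
      rw [mem_filter, mem_sdiff] at he
      rw [mem_sdiff, mem_nbhd, mem_used]
      refine ⟨⟨e.1, he.2, h.adj e he.1.1⟩, ?_⟩
      rintro (h' | ⟨e', he', h'⟩)
      · exact h.root e he.1.1 h'
      · have := h.inj (hE he') he.1.1 h'
        exact he.1.2 (this ▸ he')
  have h4 : Disjoint (nbhd G S \ used r E) (((E \ E').filter fun e => e.1 ∈ S).image Prod.snd) := by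
    rw [Finset.disjoint_left]
    intro v hv hv'
    obtain ⟨e, he, rfl⟩ := mem_image.1 hv'
    rw [mem_filter, mem_sdiff] at he
    rw [mem_sdiff, mem_used] at hv
    exact hv.2 (Or.inr ⟨e, he.1.1, rfl⟩)
  have h5 := card_le_card h3
  rw [card_union_of_disjoint h4, h2] at h5
  omega

/-- A vertex with few children can be given a new child. -/
lemma IsExtendable.exists_insert {E : Finset (V × V)} (h : IsExtendable G D m r E)
    (hG : IsJoined G m) (hE : (used r E).card + 2 * m * D + 2 * m < Fintype.card V) {x : V}
    (hx : x ∈ used r E) (hd : outdeg E x < D) :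
    ∃ y ∉ used r E, G.Adj x y ∧ IsExtendable G D m r (insert (x, y) E) := by
  -- Friedman–Pippenger argument. Call `S` critical if equality holds in the expansion condition. If
  -- a new child `y` of `x` is not allowed, some critical set misses `x` and has `y` as a neighbour.
  -- The union of these sets over all `y` is again critical, and adding `x` to it contradicts
  -- expansion.
  set U := used r E with hU
  set F : Finset V → ℕ := fun S => (nbhd G S \ U).card + ∑ v ∈ S, outdeg E v with hF
  have hexp : ∀ S : Finset V, S.card ≤ 2 * m →
      D * S.card ≤ (nbhd G S \ U).card + ∑ v ∈ S, outdeg E v := h.expand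
  -- Critical sets are small: joinedness gives a set of at least `m` vertices more than `2 * m * D`
  -- unused neighbours.
  have hlarge : ∀ S : Finset V, S.card ≤ 2 * m → F S = D * S.card → S.card < m := by
    intro S hS hc
    by_contra! hm
    have h1 := hG.card_le_nbhd hm
    have h2 := card_le_card_sdiff_add_card (t := U) (s := nbhd G S)
    have h3 : D * S.card ≤ D * (2 * m) := Nat.mul_le_mul_left _ hS
    have h4 : (nbhd G S \ U).card ≤ F S := Nat.le_add_right _ _
    have h5 : D * (2 * m) = 2 * m * D := by ring
    omega
  -- Submodularity of `F`. Smallness of critical sets keeps their unions below `2 * m`, where the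
  -- expansion condition applies, and the union is small again by `hlarge`.
  have hunion : ∀ S T : Finset V, (S.card < m ∧ F S = D * S.card) →
      (T.card < m ∧ F T = D * T.card) → (S ∪ T).card < m ∧ F (S ∪ T) = D * (S ∪ T).card := by
    rintro S T ⟨hS, hSc⟩ ⟨hT, hTc⟩
    have hle : (S ∪ T).card ≤ 2 * m := (card_union_le S T).trans (by omega)
    have h1 := hexp (S ∪ T) hle
    have h2 := hexp (S ∩ T) ((card_le_card inter_subset_left).trans (by omega))
    have h3 : (nbhd G (S ∪ T) \ U).card + (nbhd G (S ∩ T) \ U).card ≤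
        (nbhd G S \ U).card + (nbhd G T \ U).card := by
      rw [← card_union_add_card_inter (nbhd G S \ U) (nbhd G T \ U), nbhd_union, union_sdiff_distrib]
      refine Nat.add_le_add_left (card_le_card ?_) _
      intro v hv
      rw [mem_sdiff] at hv
      rw [mem_inter, mem_sdiff, mem_sdiff]
      exact ⟨⟨nbhd_mono inter_subset_left hv.1, hv.2⟩, ⟨nbhd_mono inter_subset_right hv.1, hv.2⟩⟩
    have h4 := sum_union_inter (s₁ := S) (s₂ := T) (f := outdeg E)
    have h5 : D * (S ∪ T).card + D * (S ∩ T).card = D * S.card + D * T.card := by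
      rw [← mul_add, card_union_add_card_inter, mul_add]
    have h6 : F (S ∪ T) = D * (S ∪ T).card := by
      simp only [hF] at hSc hTc ⊢
      omega
    exact ⟨hlarge _ hle h6, h6⟩
  by_contra! hno
  have hcrit : ∀ y, y ∉ U → G.Adj x y → ∃ S : Finset V, S.card < m ∧ F S = D * S.card ∧ x ∉ S ∧
      y ∈ nbhd G S := by
    intro y hy hxy
    have hnot := hno y hy hxy
    have hnm : (x, y) ∉ E := notMem_of_notMem_used hy
    have : ∃ S : Finset V, S.card ≤ 2 * m ∧
        (nbhd G S \ insert y U).card + ∑ v ∈ S, (outdeg E v + if v = x then 1 else 0) <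
          D * S.card := by
      by_contra! hall
      apply hnot
      refine ⟨?_, ?_, ?_, ?_, ?_⟩
      · intro e he
        rcases mem_insert.1 he with rfl | he
        · exact hxy
        · exact h.adj e he
      · rw [coe_insert, Set.injOn_insert (by simpa using hnm)]
        refine ⟨h.inj, ?_⟩
        rintro ⟨e, he, h'⟩
        exact hy (mem_used.2 (Or.inr ⟨e, he, h'⟩))
      · intro e he
        rcases mem_insert.1 he with rfl | he
        · rintro rfl; exact hy root_mem_used
        · exact h.root e he
      · intro e he
        rw [used_insert]
        rcases mem_insert.1 he with rfl | he
        · exact mem_insert_of_mem hx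
        · exact mem_insert_of_mem (h.parent e he)
      · intro S hS
        rw [used_insert]
        simp only [outdeg_insert hnm]
        exact hall S hS
    obtain ⟨S, hS, hlt⟩ := this
    have h1 := hexp S hS
    rw [sum_add_distrib, sum_ite_eq' S x] at hlt
    rw [sdiff_insert] at hlt
    have h3 := pred_card_le_card_erase (s := nbhd G S \ U) (a := y)
    have hxS : x ∉ S := by
      intro hxS
      rw [if_pos hxS] at hlt
      omega
    have hyS : y ∈ nbhd G S := by
      by_contra hyS
      rw [erase_eq_of_notMem (by simp [hyS])] at hlt
      omega
    have heq : F S = D * S.card := by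
      simp only [hF]
      rw [if_neg hxS] at hlt
      omega
    exact ⟨S, hlarge S hS heq, heq, hxS, hyS⟩
  choose! T hT1 hT2 hT3 hT4 using hcrit
  set N := univ.filter fun y => y ∉ U ∧ G.Adj x y with hN
  have hm0 : 0 < m := by
    by_contra hm0
    have hm0 : m = 0 := by omega
    have h1 := hG.card_le_nbhd (S := ∅) (by simp [hm0])
    have : nbhd G (∅ : Finset V) = ∅ := by ext; simp [mem_nbhd]
    rw [this] at h1
    rw [hm0, card_empty] at h1
    omega
  have hsup : (N.sup T).card < m ∧ F (N.sup T) = D * (N.sup T).card := by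
    refine Finset.sup_induction (p := fun S => S.card < m ∧ F S = D * S.card) ?_
      (fun S hS T hT => hunion S T hS hT) ?_
    · have : nbhd G (∅ : Finset V) = ∅ := by ext; simp [mem_nbhd]
      simp [hF, this, hm0]
    · intro y hy
      obtain ⟨h1, h2⟩ := (mem_filter.1 hy).2
      exact ⟨hT1 y h1 h2, hT2 y h1 h2⟩
  have hxs : x ∉ N.sup T := by
    rw [Finset.mem_sup]
    rintro ⟨y, hy, hxy⟩
    obtain ⟨h1, h2⟩ := (mem_filter.1 hy).2
    exact hT3 y h1 h2 hxy
  -- All unused neighbours of `x` are already neighbours of the union, so adding `x` raises `F` only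
  -- by `outdeg E x < D`, while the required bound rises by `D`.
  have h1 := hexp (insert x (N.sup T)) (by rw [card_insert_of_notMem hxs]; omega)
  have h2 : nbhd G (insert x (N.sup T)) \ U ⊆ nbhd G (N.sup T) \ U := by
    intro v hv
    rw [mem_sdiff, mem_nbhd] at hv
    obtain ⟨⟨s, hs, hsv⟩, hvU⟩ := hv
    rw [mem_sdiff]
    refine ⟨?_, hvU⟩
    rcases mem_insert.1 hs with rfl | hs
    · have hvN : v ∈ N := mem_filter.2 ⟨mem_univ _, hvU, hsv⟩
      exact nbhd_mono (Finset.le_sup (f := T) hvN) (hT4 v hvU hsv)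
    · exact mem_nbhd.2 ⟨s, hs, hsv⟩
  have h3 := card_le_card h2
  rw [sum_insert hxs, card_insert_of_notMem hxs, mul_add] at h1
  have h4 := hsup.2
  simp only [hF] at h4
  omega

end ExpanderPartition

/-! ### Binary trees and connecting paths in extendable forests -/

namespace ExpanderPartition

open Finset
open scoped Classical

variable {V : Type*} {G : SimpleGraph V} {D m : ℕ} {r : V}

/-- The oriented edges of a path given by its list of vertices. -/
noncomputable def pathEdges : List V → Finset (V × V)
  | x :: y :: l => insert (x, y) (pathEdges (y :: l))
  | _ => ∅

lemma pathEdges_subset {E : Finset (V × V)} : ∀ {l : List V},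
    l.IsChain (fun a b => (a, b) ∈ E) → pathEdges l ⊆ E
  | [], _ => by simp [pathEdges]
  | [_], _ => by simp [pathEdges]
  | x :: y :: l, h => by
    rw [List.isChain_cons_cons] at h
    rw [pathEdges, insert_subset_iff]
    exact ⟨h.1, pathEdges_subset h.2⟩

lemma image_snd_pathEdges (x : V) (l : List V) :
    (pathEdges (x :: l)).image Prod.snd = l.toFinset := by
  induction l generalizing x with
  | nil => simp [pathEdges]
  | cons y l ih => rw [pathEdges, image_insert, ih, List.toFinset_cons]

lemma fst_mem_of_mem_pathEdges {e : V × V} : ∀ {l : List V}, e ∈ pathEdges l → e.1 ∈ l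
  | [], h => by simp [pathEdges] at h
  | [_], h => by simp [pathEdges] at h
  | x :: y :: l, h => by
    rw [pathEdges, mem_insert] at h
    rcases h with rfl | h
    · simp
    · exact List.mem_cons_of_mem _ (fst_mem_of_mem_pathEdges h)

lemma outdeg_pathEdges_eq_zero {l : List V} {v : V} (hv : v ∉ l) : outdeg (pathEdges l) v = 0 := by
  rw [outdeg, card_eq_zero, filter_eq_empty_iff]
  rintro e he rfl
  exact hv (fst_mem_of_mem_pathEdges he)

lemma outdeg_pathEdges_le : ∀ {l : List V}, l.Nodup → ∀ v, outdeg (pathEdges l) v ≤ 1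
  | [], _, v => by simp [pathEdges, outdeg]
  | [_], _, v => by simp [pathEdges, outdeg]
  | x :: y :: l, h, v => by
    rw [List.nodup_cons] at h
    have hn : (x, y) ∉ pathEdges (y :: l) := fun h' => h.1 (fst_mem_of_mem_pathEdges h')
    rw [pathEdges, outdeg_insert hn]
    by_cases hv : v = x
    · subst hv
      simp [outdeg_pathEdges_eq_zero h.1]
    · simpa [hv] using outdeg_pathEdges_le h.2 v

lemma used_union_pathEdges (E : Finset (V × V)) (x : V) (l : List V) :
    used r (E ∪ pathEdges (x :: l)) = used r E ∪ l.toFinset := by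
  simp only [used, image_union, image_snd_pathEdges, insert_union]

variable [Fintype V]

/-- From `x` grow a binary tree of height `h` hanging off a path of length `j`. -/
lemma IsExtendable.exists_spread (hG : IsJoined G m) {M : ℕ}
    (hM : M + 2 * m * D + 2 * m < Fintype.card V) (hD : 2 ≤ D) (h : ℕ) :
    ∀ (j : ℕ) (E : Finset (V × V)) (x : V), IsExtendable G D m r E → x ∈ used r E →
      outdeg E x + 2 ≤ D → (used r E).card + j + 2 ^ (h + 1) ≤ M →
    ∃ (E' : Finset (V × V)) (L : Finset V), IsExtendable G D m r E' ∧ E ⊆ E' ∧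
      (used r E').card + 2 ≤ (used r E).card + j + 2 ^ (h + 1) ∧ L.card = 2 ^ h ∧
      (∀ v ∈ used r E, v ≠ x → outdeg E' v = outdeg E v) ∧
      ∀ v ∈ L, ∃ I : List V, I.length = j + h ∧ I.Nodup ∧
        (∀ w ∈ I, w ∉ used r E ∧ w ∈ used r E') ∧
        (x :: I).IsChain (fun a b => (a, b) ∈ E') ∧ (x :: I).getLast (by simp) = v := by
  intro j
  induction j with
  | zero =>
    induction h with
    | zero =>
      intro E x hE hx hd hM'
      refine ⟨E, {x}, hE, Subset.rfl, by simp, by simp, fun _ _ _ => rfl, ?_⟩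
      intro v hv
      rw [mem_singleton] at hv
      exact ⟨[], by simp, by simp, by simp, by simp, by simp [hv]⟩
    | succ h ih =>
      intro E x hE hx hd hM'
      have h2 : 2 ^ (h + 1 + 1) = 2 * 2 ^ (h + 1) := by rw [pow_succ, mul_comm]
      have h2' : 2 ≤ 2 ^ (h + 1) := by rw [pow_succ]; have := Nat.one_le_two_pow (n := h); omega
      obtain ⟨y, hy, hxy, hE1⟩ := hE.exists_insert hG (x := x) (by omega) hx (by omega)
      have o1 := outdeg_insert (notMem_of_notMem_used (x := x) hy)
      have u1 := used_insert (r := r) E x y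
      set E1 := insert (x, y) E with hE1d
      have hxx : outdeg E1 x = outdeg E x + 1 := by rw [o1]; simp
      have c1 : (used r E1).card = (used r E).card + 1 := by rw [u1, card_insert_of_notMem hy]
      obtain ⟨z, hz, hxz, hE2⟩ := hE1.exists_insert hG (x := x) (by omega)
        (by rw [u1]; exact mem_insert_of_mem hx) (by omega)
      have o2 := outdeg_insert (notMem_of_notMem_used (x := x) hz)
      have u2 := used_insert (r := r) E1 x z
      set E2 := insert (x, z) E1 with hE2d
      have c2 : (used r E2).card = (used r E).card + 2 := by rw [u2, card_insert_of_notMem hz, c1]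
      rw [u1, mem_insert, not_or] at hz
      have hyx : y ≠ x := by rintro rfl; exact hy hx
      have hzx : z ≠ x := by rintro rfl; exact hz.2 hx
      have oy : outdeg E2 y = 0 := by simp [o2, o1, hyx, hE.outdeg_eq_zero hy]
      have oz : outdeg E2 z = 0 := by simp [o2, o1, hzx, hE.outdeg_eq_zero hz.2]
      have hy2 : y ∈ used r E2 := by simp [u2, u1]
      have hz2 : z ∈ used r E2 := by simp [u2]
      -- The subtree at `y` is completed before that at `z`; `z` remains childless meanwhile
      -- because, among the vertices used so far, only the root of the growing subtree gets
      -- children.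
      obtain ⟨E3, L1, hE3, s3, c3, l1, o3, p3⟩ := ih E2 y hE2 hy2 (by omega) (by omega)
      obtain ⟨E4, L2, hE4, s4, c4, l2, o4, p4⟩ := ih E3 z hE3 (used_mono s3 hz2)
        (by rw [o3 z hz2 hz.1]; omega) (by omega)
      have hE02 : E ⊆ E2 := (subset_insert _ _).trans (subset_insert _ _)
      have hxy4 : (x, y) ∈ E4 := s4 (s3 (by simp [hE2d, hE1d]))
      have hxz4 : (x, z) ∈ E4 := s4 (s3 (by simp [hE2d]))
      have hlast : ∀ (I : List V) (a : V), (a :: I).getLast (by simp) = a ∨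
          (a :: I).getLast (by simp) ∈ I := by
        intro I a
        exact List.mem_cons.1 (List.getLast_mem (l := a :: I) (by simp))
      refine ⟨E4, L1 ∪ L2, hE4, hE02.trans (s3.trans s4), by omega, ?_, ?_, ?_⟩
      · rw [card_union_of_disjoint, l1, l2, pow_succ]; omega
        rw [Finset.disjoint_left]
        intro v hv1 hv2
        obtain ⟨I, -, -, hI, -, hl⟩ := p3 v hv1
        obtain ⟨J, -, -, hJ, -, hl'⟩ := p4 v hv2
        rcases hlast I y with h | h <;> rcases hlast J z with h' | h' <;>
          rw [hl] at h <;> rw [hl'] at h'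
        · exact hz.1 (h' ▸ h)
        · exact (hJ v h').1 (used_mono s3 (h ▸ hy2))
        · exact (hI v h).1 (h' ▸ hz2)
        · exact (hJ v h').1 (hI v h).2
      · intro v hv hvx
        have hvy : v ≠ y := by rintro rfl; exact hy hv
        have hvz : v ≠ z := by rintro rfl; exact hz.2 hv
        have hv2 := used_mono hE02 hv
        rw [o4 v (used_mono s3 hv2) hvz, o3 v hv2 hvy, o2, o1]
        simp [hvx]
      · intro v hv
        rw [mem_union] at hv
        rcases hv with hv | hv
        · obtain ⟨I, hI1, hI2, hI3, hI4, hI5⟩ := p3 v hv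
          refine ⟨y :: I, by simp [hI1], ?_, ?_, ?_, by simpa using hI5⟩
          · rw [List.nodup_cons]
            exact ⟨fun h => (hI3 y h).1 hy2, hI2⟩
          · intro w hw
            rcases List.mem_cons.1 hw with rfl | hw
            · exact ⟨hy, used_mono (s3.trans s4) hy2⟩
            · exact ⟨fun h => (hI3 w hw).1 (used_mono hE02 h), used_mono s4 (hI3 w hw).2⟩
          · rw [List.isChain_cons_cons]
            exact ⟨hxy4, hI4.imp fun a b hab => s4 hab⟩
        · obtain ⟨I, hI1, hI2, hI3, hI4, hI5⟩ := p4 v hv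
          refine ⟨z :: I, by simp [hI1], ?_, ?_, ?_, by simpa using hI5⟩
          · rw [List.nodup_cons]
            exact ⟨fun h => (hI3 z h).1 (used_mono s3 hz2), hI2⟩
          · intro w hw
            rcases List.mem_cons.1 hw with rfl | hw
            · exact ⟨hz.2, used_mono (s3.trans s4) hz2⟩
            · exact ⟨fun h => (hI3 w hw).1 (used_mono (hE02.trans s3) h), (hI3 w hw).2⟩
          · rw [List.isChain_cons_cons]
            exact ⟨hxz4, hI4⟩
  | succ j ih =>
    intro E x hE hx hd hM'
    have h2' : 2 ≤ 2 ^ (h + 1) := by rw [pow_succ]; have := Nat.one_le_two_pow (n := h); omega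
    obtain ⟨y, hy, hxy, hE1⟩ := hE.exists_insert hG (x := x) (by omega) hx (by omega)
    have o1 := outdeg_insert (notMem_of_notMem_used (x := x) hy)
    have u1 := used_insert (r := r) E x y
    set E1 := insert (x, y) E with hE1d
    have c1 : (used r E1).card = (used r E).card + 1 := by rw [u1, card_insert_of_notMem hy]
    have hyx : y ≠ x := by rintro rfl; exact hy hx
    have oy : outdeg E1 y = 0 := by simp [o1, hyx, hE.outdeg_eq_zero hy]
    have hy1 : y ∈ used r E1 := by simp [u1]
    have s1 : E ⊆ E1 := subset_insert _ _
    obtain ⟨E2, L, hE2, s2, c2, l2, o2, p2⟩ := ih E1 y hE1 hy1 (by omega) (by omega)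
    refine ⟨E2, L, hE2, s1.trans s2, by omega, l2, ?_, ?_⟩
    · intro v hv hvx
      have hvy : v ≠ y := by rintro rfl; exact hy hv
      rw [o2 v (used_mono s1 hv) hvy, o1]
      simp [hvx]
    · intro v hv
      obtain ⟨I, hI1, hI2, hI3, hI4, hI5⟩ := p2 v hv
      refine ⟨y :: I, by simp [hI1]; omega, ?_, ?_, ?_, by simpa using hI5⟩
      · rw [List.nodup_cons]
        exact ⟨fun h => (hI3 y h).1 hy1, hI2⟩
      · intro w hw
        rcases List.mem_cons.1 hw with rfl | hw
        · exact ⟨hy, used_mono s2 hy1⟩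
        · exact ⟨fun h => (hI3 w hw).1 (used_mono s1 h), (hI3 w hw).2⟩
      · rw [List.isChain_cons_cons]
        exact ⟨s2 (mem_insert_self _ _), hI4⟩

/-- Parameters for which extendable forests with at most `K` vertices can be extended by
connecting paths. -/
structure IsHost (G : SimpleGraph V) (D m h K : ℕ) : Prop where
  joined : IsJoined G m
  le_pow : m ≤ 2 ^ h
  room : K + 2 ^ (h + 2) + 2 * m * D + 2 * m < Fintype.card V
  deg : 100 ≤ D

variable {h K : ℕ}

/-- Two used vertices can be connected by a path with `q` new interior vertices. -/
lemma IsExtendable.exists_connect (hG : IsHost G D m h K) {E : Finset (V × V)}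
    (hE : IsExtendable G D m r E) {x y : V} (hx : x ∈ used r E) (hy : y ∈ used r E) (hxy : x ≠ y)
    (hdx : outdeg E x + 2 ≤ D) (hdy : outdeg E y + 2 ≤ D) {q : ℕ} (hq : 2 * h ≤ q)
    (hK : (used r E).card + q ≤ K) :
    ∃ (I : List V) (E' : Finset (V × V)), I.length = q ∧ I.Nodup ∧ (∀ v ∈ I, v ∉ used r E) ∧
      (x :: I ++ [y]).IsChain G.Adj ∧ IsExtendable G D m r E' ∧
      used r E' = used r E ∪ I.toFinset ∧
      (∀ v ∈ used r E, outdeg E' v ≤ outdeg E v + if v = x ∨ v = y then 1 else 0) ∧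
      ∀ v ∉ used r E, outdeg E' v ≤ 1 := by
  have hdeg := hG.deg
  have hroom := hG.room
  have h2 : 2 ^ (h + 2) = 2 ^ (h + 1) + 2 ^ (h + 1) := by ring
  have h2' := Nat.one_le_two_pow (n := h)
  -- The stem of length `q - 2 * h` at `x` adjusts the length: together with two tree branches of
  -- length `h` it gives `q` interior vertices.
  obtain ⟨E1, L1, hE1, s1, c1, l1, o1, p1⟩ := IsExtendable.exists_spread hG.joined
    (M := K + 2 ^ (h + 2)) hroom (by omega) h (q - 2 * h) E x hE hx hdx (by omega)
  obtain ⟨E2, L2, hE2, s2, c2, l2, o2, p2⟩ := IsExtendable.exists_spread hG.joined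
    (M := K + 2 ^ (h + 2)) hroom (by omega) h 0 E1 y hE1 (used_mono s1 hy)
    (by rw [o1 y hy hxy.symm]; omega) (by omega)
  have hlast : ∀ (I : List V) (a : V), (a :: I).getLast (by simp) = a ∨
      (a :: I).getLast (by simp) ∈ I := by
    intro I a
    exact List.mem_cons.1 (List.getLast_mem (l := a :: I) (by simp))
  have hdisj : Disjoint L1 L2 := by
    rw [Finset.disjoint_left]
    intro v hv1 hv2
    obtain ⟨I, -, -, hI, -, hl⟩ := p1 v hv1
    obtain ⟨J, -, -, hJ, -, hl'⟩ := p2 v hv2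
    rcases hlast I x with h | h <;> rcases hlast J y with h' | h' <;>
      rw [hl] at h <;> rw [hl'] at h'
    · exact hxy (h ▸ h')
    · exact (hJ v h').1 (used_mono s1 (h ▸ hx))
    · exact (hI v h).1 (h' ▸ hy)
    · exact (hJ v h').1 (hI v h).2
  obtain ⟨u, hu, w, hw, huw⟩ := hG.joined L1 L2 hdisj (l1 ▸ hG.le_pow) (l2 ▸ hG.le_pow)
  obtain ⟨I, hI1, hI2, hI3, hI4, hI5⟩ := p1 u hu
  obtain ⟨J, hJ1, hJ2, hJ3, hJ4, hJ5⟩ := p2 w hw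
  have hI4' : (x :: I).IsChain (fun a b => (a, b) ∈ E2) := hI4.imp fun a b hab => s2 hab
  have hJE : ∀ w ∈ J, w ∉ used r E := fun w hw h => (hJ3 w hw).1 (used_mono s1 h)
  have hxI : x ∉ I := fun h => (hI3 x h).1 hx
  have hyJ : y ∉ J := fun h => hJE y h hy
  have hxJ : x ∉ J := fun h => hJE x h hx
  have hyI : y ∉ I := fun h => (hI3 y h).1 hy
  have hIJ : I.Disjoint J := fun v hv hv' => (hJ3 v hv').1 (hI3 v hv).2
  -- The edge `uw` between the trees is not recorded: both halves stay oriented away from `x` and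
  -- `y`, so that every vertex keeps a single parent.
  set E' := E ∪ pathEdges (x :: I) ∪ pathEdges (y :: J) with hE'
  have hused : used r E' = used r E ∪ (I ++ J.reverse).toFinset := by
    rw [hE', used_union_pathEdges, used_union_pathEdges, List.toFinset_append,
      List.toFinset_reverse, union_assoc]
  have hsub : E' ⊆ E2 :=
    union_subset (union_subset (s1.trans s2) (pathEdges_subset hI4')) (pathEdges_subset hJ4)
  have hod : ∀ v, outdeg E' v ≤ outdeg E v + outdeg (pathEdges (x :: I)) v +
      outdeg (pathEdges (y :: J)) v := fun v =>
    (outdeg_union_le _ _ v).trans (Nat.add_le_add_right (outdeg_union_le _ _ v) _)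
  have hnI : (x :: I).Nodup := List.nodup_cons.2 ⟨hxI, hI2⟩
  have hnJ : (y :: J).Nodup := List.nodup_cons.2 ⟨hyJ, hJ2⟩
  refine ⟨I ++ J.reverse, E', by simp [hI1, hJ1]; omega, ?_, ?_, ?_, ?_, hused, ?_, ?_⟩
  · rw [List.nodup_append']
    exact ⟨hI2, List.nodup_reverse.2 hJ2, by simpa using hIJ⟩
  · intro v hv
    rw [List.mem_append, List.mem_reverse] at hv
    rcases hv with hv | hv
    · exact (hI3 v hv).1
    · exact hJE v hv
  · have : x :: (I ++ J.reverse) ++ [y] = (x :: I) ++ (y :: J).reverse := by simp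
    rw [this]
    refine List.IsChain.append (hI4'.imp fun a b hab => hE2.adj _ hab) ?_ ?_
    · rw [List.isChain_reverse]
      exact hJ4.imp fun a b hab => (hE2.adj _ hab).symm
    · intro a ha b hb
      rw [List.getLast?_eq_getLast_of_ne_nil (by simp), hI5] at ha
      rw [List.head?_reverse, List.getLast?_eq_getLast_of_ne_nil (by simp), hJ5] at hb
      simp only [Option.mem_def, Option.some.injEq] at ha hb
      exact ha ▸ hb ▸ huw
  · refine hE2.rollback hsub ?_
    intro e he
    rw [hused, mem_union, List.mem_toFinset, List.mem_append, List.mem_reverse]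
    rw [hE', mem_union, mem_union] at he
    rcases he with (he | he) | he
    · exact Or.inl (hE.parent e he)
    · rcases List.mem_cons.1 (fst_mem_of_mem_pathEdges he) with h | h
      · exact Or.inl (h ▸ hx)
      · exact Or.inr (Or.inl h)
    · rcases List.mem_cons.1 (fst_mem_of_mem_pathEdges he) with h | h
      · exact Or.inl (h ▸ hy)
      · exact Or.inr (Or.inr h)
  · intro v hv
    refine (hod v).trans ?_
    have hvI : v ∉ I := fun h => (hI3 v h).1 hv
    have hvJ : v ∉ J := fun h => hJE v h hv
    by_cases hvx : v = x
    · have hvy : v ≠ y := hvx ▸ hxy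
      have := outdeg_pathEdges_le hnI v
      rw [outdeg_pathEdges_eq_zero (l := y :: J) (by simp [hvy, hvJ])]
      simp only [hvx, true_or, if_true] at this ⊢
      omega
    · rw [outdeg_pathEdges_eq_zero (l := x :: I) (by simp [hvx, hvI])]
      by_cases hvy : v = y
      · have := outdeg_pathEdges_le hnJ v
        simp only [hvy, or_true, if_true] at this ⊢
        omega
      · rw [outdeg_pathEdges_eq_zero (l := y :: J) (by simp [hvy, hvJ])]
        simp
  · intro v hv
    refine (hod v).trans ?_
    rw [hE.outdeg_eq_zero hv]
    have hvx : v ≠ x := fun h => hv (h ▸ hx)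
    have hvy : v ≠ y := fun h => hv (h ▸ hy)
    by_cases hvI : v ∈ I
    · rw [outdeg_pathEdges_eq_zero (l := y :: J) (by simp [hvy]; exact hIJ hvI)]
      have := outdeg_pathEdges_le hnI v
      omega
    · rw [outdeg_pathEdges_eq_zero (l := x :: I) (by simp [hvx, hvI])]
      have := outdeg_pathEdges_le hnJ v
      omega

/-- Several pairs of used vertices can be connected by disjoint paths with prescribed numbers
of new interior vertices. -/
lemma IsExtendable.exists_connect_family (hG : IsHost G D m h K) {E : Finset (V × V)}
    (hE : IsExtendable G D m r E) {ι : Type*} (x y : ι → V) (q : ι → ℕ) (s : Finset ι)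
    (hx : ∀ i ∈ s, x i ∈ used r E) (hy : ∀ i ∈ s, y i ∈ used r E) (hxy : ∀ i ∈ s, x i ≠ y i)
    (hd : ∀ v ∈ used r E, outdeg E v + (s.filter fun i => v = x i ∨ v = y i).card + 2 ≤ D)
    (hq : ∀ i ∈ s, 2 * h ≤ q i) (hK : (used r E).card + ∑ i ∈ s, q i ≤ K) :
    ∃ (I : ι → List V) (E' : Finset (V × V)),
      (∀ i ∈ s, (I i).length = q i ∧ (I i).Nodup ∧ (x i :: I i ++ [y i]).IsChain G.Adj ∧
        ∀ v ∈ I i, v ∉ used r E) ∧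
      (∀ i ∈ s, ∀ j ∈ s, i ≠ j → (I i).Disjoint (I j)) ∧
      IsExtendable G D m r E' ∧ used r E' = used r E ∪ s.biUnion (fun i => (I i).toFinset) ∧
      (used r E').card = (used r E).card + ∑ i ∈ s, q i ∧
      (∀ v ∈ used r E,
        outdeg E' v ≤ outdeg E v + (s.filter fun i => v = x i ∨ v = y i).card) ∧
      ∀ v ∉ used r E, outdeg E' v ≤ 1 := by
  induction s using Finset.induction_on with
  | empty =>
    exact ⟨fun _ => [], E, by simp, by simp, hE, by simp, by simp, by simp,
      fun v hv => by simp [hE.outdeg_eq_zero hv]⟩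
  | insert i s hi ih =>
    rw [sum_insert hi] at hK
    have hfil : ∀ v, ((insert i s).filter fun i => v = x i ∨ v = y i).card =
        (s.filter fun i => v = x i ∨ v = y i).card + if v = x i ∨ v = y i then 1 else 0 := by
      intro v
      rw [filter_insert]
      split_ifs with hv
      · rw [card_insert_of_notMem (by simp [hi])]
      · rfl
    obtain ⟨I, E1, a1, a2, a3, a4, a5, a6, a7⟩ := ih
      (fun j hj => hx j (mem_insert_of_mem hj)) (fun j hj => hy j (mem_insert_of_mem hj))
      (fun j hj => hxy j (mem_insert_of_mem hj))
      (fun v hv => by have := hd v hv; rw [hfil] at this; omega)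
      (fun j hj => hq j (mem_insert_of_mem hj)) (by omega)
    have hxi := hx i (mem_insert_self _ _)
    have hyi := hy i (mem_insert_self _ _)
    have hsub : used r E ⊆ used r E1 := a4 ▸ subset_union_left
    obtain ⟨J, E2, b1, b2, b3, b4, b5, b6, b7, b8⟩ := a3.exists_connect hG (hsub hxi) (hsub hyi)
      (hxy i (mem_insert_self _ _))
      (by have h1 := a6 _ hxi; have h2 := hd _ hxi; rw [hfil] at h2; omega)
      (by have h1 := a6 _ hyi; have h2 := hd _ hyi; rw [hfil] at h2; omega)
      (hq i (mem_insert_self _ _)) (by rw [a5]; omega)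
    have hne : ∀ j ∈ s, j ≠ i := fun j hj h => hi (h ▸ hj)
    have hJI : ∀ j ∈ s, J.Disjoint (I j) := by
      intro j hj v hv hv'
      apply b3 v hv
      rw [a4, mem_union, mem_biUnion]
      exact Or.inr ⟨j, hj, by simpa using hv'⟩
    refine ⟨Function.update I i J, E2, ?_, ?_, b5, ?_, ?_, ?_, ?_⟩
    · intro j hj
      rcases mem_insert.1 hj with rfl | hj
      · rw [Function.update_self]
        exact ⟨b1, b2, b4, fun v hv h => b3 v hv (hsub h)⟩
      · rw [Function.update_of_ne (hne j hj)]
        exact a1 j hj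
    · intro j hj k hk hjk
      rcases mem_insert.1 hj with hj' | hj' <;> rcases mem_insert.1 hk with hk' | hk'
      · exact absurd (hj'.trans hk'.symm) hjk
      · rw [hj', Function.update_self, Function.update_of_ne (hne k hk')]
        exact hJI k hk'
      · rw [hk', Function.update_self, Function.update_of_ne (hne j hj')]
        exact (hJI j hj').symm
      · rw [Function.update_of_ne (hne j hj'), Function.update_of_ne (hne k hk')]
        exact a2 j hj' k hk' hjk
    · rw [b6, a4, biUnion_insert, Function.update_self, union_assoc, union_comm _ J.toFinset]
      congr 2
      refine biUnion_congr rfl fun j hj => ?_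
      rw [Function.update_of_ne (hne j hj)]
    · rw [b6, card_union_of_disjoint, a5, sum_insert hi, List.toFinset_card_of_nodup b2, b1]
      · omega
      · rw [Finset.disjoint_right]
        intro v hv
        exact b3 v (by simpa using hv)
    · intro v hv
      have h1 := a6 v hv
      have h2 := b7 v (hsub hv)
      rw [hfil]
      omega
    · intro v hv
      by_cases hv1 : v ∈ used r E1
      · have h2 := b7 v hv1
        rw [if_neg] at h2
        · have := a7 v hv; omega
        · rintro (rfl | rfl) <;> contradiction
      · exact b8 v hv1

end ExpanderPartition

namespace ExpanderPartition

open Finset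
open scoped Classical

variable {V : Type*} {G : SimpleGraph V} {D m : ℕ} {r : V}

/-! ### Switches -/

/-- The path that starts at `w` and traverses the paths `x i, I i, y i` for `i < s` in alternating
directions. -/
def zigzag (w : V) (x y : ℕ → V) (I : ℕ → List V) (ε : Bool) : ℕ → List V
  | 0 => [w]
  | s + 1 => zigzag w x y I ε s ++
      if xor s.bodd ε then x s :: I s ++ [y s] else (x s :: I s ++ [y s]).reverse

/-- A zigzag runs along the rungs of a ladder with sides `x` and `y`. It changes sides at every
rung, so the parity of `s` and the starting side `ε` determine the side on which it leaves. -/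
lemma zigzag_isChain {w : V} {x y : ℕ → V} {I : ℕ → List V} (ε : Bool) (hx0 : G.Adj w (x 0))
    (hy0 : G.Adj w (y 0)) (s : ℕ) (hI : ∀ i < s, (x i :: I i ++ [y i]).IsChain G.Adj)
    (hx : ∀ i < s, G.Adj (x i) (x (i + 1))) (hy : ∀ i < s, G.Adj (y i) (y (i + 1))) :
    (zigzag w x y I ε s ++ [if xor s.bodd ε then x s else y s]).IsChain G.Adj := by
  induction s with
  | zero => cases ε <;> simp [zigzag, hx0, hy0]
  | succ s ih =>
    specialize ih (fun i hi => hI i (by omega)) (fun i hi => hx i (by omega))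
      (fun i hi => hy i (by omega))
    have h1 := hI s (by omega)
    cases ho : xor s.bodd ε with
    | true =>
      have ho' : xor (s + 1).bodd ε = false := by simpa using ho
      rw [ho, if_pos rfl] at ih
      rw [ho', zigzag, ho, if_pos rfl, if_neg (by simp), List.append_assoc, List.cons_append,
        List.cons_append, List.isChain_split]
      refine ⟨ih, ?_⟩
      rw [List.append_assoc, List.singleton_append, ← List.cons_append, List.isChain_split]
      exact ⟨h1, by simpa using hy s (by omega)⟩
    | false =>
      have ho' : xor (s + 1).bodd ε = true := by
        rw [Nat.bodd_succ]; revert ho; cases s.bodd <;> cases ε <;> simp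
      rw [ho, if_neg (by simp)] at ih
      have h2 : (x s :: I s ++ [y s]).reverse = y s :: ((I s).reverse ++ [x s]) := by simp
      have h3 : (y s :: ((I s).reverse ++ [x s])).IsChain G.Adj := by
        rw [← h2, List.isChain_reverse]
        exact h1.imp fun a b hab => hab.symm
      rw [ho', zigzag, ho, if_pos rfl, if_neg (by simp), h2, List.append_assoc, List.cons_append,
        List.isChain_split]
      refine ⟨ih, ?_⟩
      rw [List.append_assoc, List.singleton_append, ← List.cons_append, List.isChain_split]
      exact ⟨h3, by simpa using hx s (by omega)⟩

/-- The reason why a switch works: the starting side changes the exit of the zigzag but not the set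
of vertices it covers. -/
lemma zigzag_perm (w : V) (x y : ℕ → V) (I : ℕ → List V) (ε ε' : Bool) (s : ℕ) :
    (zigzag w x y I ε s).Perm (zigzag w x y I ε' s) := by
  induction s with
  | zero => exact List.Perm.refl _
  | succ s ih =>
    refine ih.append ?_
    split_ifs
    · exact List.Perm.refl _
    · exact (List.reverse_perm _).symm
    · exact List.reverse_perm _
    · exact List.Perm.refl _

lemma length_zigzag (w : V) (x y : ℕ → V) (I : ℕ → List V) (ε : Bool) (q s : ℕ)
    (hI : ∀ i < s, (I i).length = q) : (zigzag w x y I ε s).length = 1 + s * (q + 2) := by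
  induction s with
  | zero => simp [zigzag]
  | succ s ih =>
    have h2 : (if xor s.bodd ε then x s :: I s ++ [y s] else (x s :: I s ++ [y s]).reverse).length
        = q + 2 := by
      split_ifs <;> simp [hI s (by omega)]
    rw [zigzag, List.length_append, ih fun i hi => hI i (by omega), h2]
    ring

lemma mem_zigzag {w : V} {x y : ℕ → V} {I : ℕ → List V} {ε : Bool} {s : ℕ} {v : V} :
    v ∈ zigzag w x y I ε s ↔ v = w ∨ ∃ i < s, v = x i ∨ v = y i ∨ v ∈ I i := by
  induction s with
  | zero => simp [zigzag]
  | succ s ih =>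
    have h2 : v ∈ (if xor s.bodd ε then x s :: I s ++ [y s] else (x s :: I s ++ [y s]).reverse) ↔
        v = x s ∨ v = y s ∨ v ∈ I s := by
      split_ifs <;> simp only [List.mem_reverse, List.cons_append, List.mem_cons, List.mem_append,
        List.not_mem_nil, or_false] <;> tauto
    rw [zigzag, List.mem_append, ih, h2]
    constructor
    · rintro ((h | ⟨i, hi, h⟩) | h)
      · exact Or.inl h
      · exact Or.inr ⟨i, by omega, h⟩
      · exact Or.inr ⟨s, by omega, h⟩
    · rintro (h | ⟨i, hi, h⟩)
      · exact Or.inl (Or.inl h)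
      · rcases Nat.lt_succ_iff_lt_or_eq.1 hi with hi | rfl
        · exact Or.inl (Or.inr ⟨i, hi, h⟩)
        · exact Or.inr h

/-- A list covering all elements of a set that are missing in a subset, and of no more than the
necessary length, has no repetitions and avoids the subset. -/
lemma nodup_of_subset_union {U U' : Finset V} {l : List V} (h : U' ⊆ U ∪ l.toFinset)
    (hc : U'.card = U.card + l.length) :
    l.Nodup ∧ (∀ v ∈ l, v ∉ U) ∧ U' = U ∪ l.toFinset := by
  have h1 := card_le_card h
  have h2 := card_union_le U l.toFinset
  have h3 := List.toFinset_card_le l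
  have h4 : (U ∪ l.toFinset).card = U.card + l.toFinset.card := by omega
  refine ⟨?_, ?_, eq_of_subset_of_card_le h (by omega)⟩
  · rw [← List.dedup_eq_self]
    apply (List.dedup_sublist l).eq_of_length
    rw [← List.card_toFinset]
    omega
  · intro v hv hU
    rw [card_union_eq_card_add_card, Finset.disjoint_left] at h4
    exact h4 hU (by simpa using hv)

/-- The chain of a concatenation of two paths sharing the vertex `c`. -/
lemma isChain_join {a b c : V} {l₁ l₂ : List V} (h₁ : (a :: l₁ ++ [c]).IsChain G.Adj)
    (h₂ : (c :: l₂ ++ [b]).IsChain G.Adj) : (a :: (l₁ ++ c :: l₂) ++ [b]).IsChain G.Adj := by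
  have : a :: (l₁ ++ c :: l₂) ++ [b] = (a :: l₁) ++ c :: (l₂ ++ [b]) := by simp
  rw [this, List.isChain_split]
  exact ⟨h₁, h₂⟩

variable [Fintype V] {h K : ℕ}

/-- Two pairs of used vertices can be linked by a switch: a set of new vertices that can be
distributed to the interiors of paths `a₁b₁`, `a₂b₂` as well as of paths `a₁b₂`, `a₂b₁`, where all
paths have the same length. -/
lemma IsExtendable.exists_switch (hG : IsHost G D m h K) {E : Finset (V × V)}
    (hE : IsExtendable G D m r E) {a₁ a₂ b₁ b₂ : V} (ha₁ : a₁ ∈ used r E) (ha₂ : a₂ ∈ used r E)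
    (hb₁ : b₁ ∈ used r E) (hb₂ : b₂ ∈ used r E) (hod : ∀ v, outdeg E v ≤ 50)
    (hK : (used r E).card + 2 * (2 * (h + 1) ^ 2) ≤ K) :
    ∃ (I₁ I₂ J₁ J₂ : List V) (E' : Finset (V × V)),
      (I₁.length = 2 * (h + 1) ^ 2 ∧ I₂.length = 2 * (h + 1) ^ 2 ∧
        J₁.length = 2 * (h + 1) ^ 2 ∧ J₂.length = 2 * (h + 1) ^ 2) ∧
      ((a₁ :: I₁ ++ [b₁]).IsChain G.Adj ∧ (a₂ :: I₂ ++ [b₂]).IsChain G.Adj ∧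
        (a₁ :: J₁ ++ [b₂]).IsChain G.Adj ∧ (a₂ :: J₂ ++ [b₁]).IsChain G.Adj) ∧
      (I₁ ++ I₂).Nodup ∧ (J₁ ++ J₂).Perm (I₁ ++ I₂) ∧ (∀ v ∈ I₁ ++ I₂, v ∉ used r E) ∧
      IsExtendable G D m r E' ∧ used r E' = used r E ∪ (I₁ ++ I₂).toFinset ∧
      (∀ v ∈ used r E,
        outdeg E' v ≤ outdeg E v + if v = a₁ ∨ v = a₂ ∨ v = b₁ ∨ v = b₂ then 4 else 0) ∧
      ∀ v ∉ used r E, outdeg E' v ≤ 6 := by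
  have hdeg := hG.deg
  have hroom := hG.room
  -- Vertex count of the switch: `2 * h + 4` on the cycle, `h` rungs with `2 * h` interior vertices,
  -- one long tail with `h * (2 * h + 2)` and two short tails with `2 * h` each.
  have harith : 2 * (2 * (h + 1) ^ 2) = 4 + (2 * h + (h * (2 * h) + (h * (2 * h + 2) + 4 * h))) := by
    ring
  have h2' := Nat.one_le_two_pow (n := h + 2)
  have hhalf : 2 * (h + 1) ^ 2 = h * (2 * h + 2) + 2 + 2 * h := by ring
  -- the cycle
  obtain ⟨w, hw, haw, hE1⟩ := hE.exists_insert hG.joined (x := a₁) (by omega) ha₁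
    (by have := hod a₁; omega)
  have o1 := outdeg_insert (notMem_of_notMem_used (x := a₁) hw)
  have u1 := used_insert (r := r) E a₁ w
  set E1 := insert (a₁, w) E with hE1d
  have c1 : (used r E1).card = (used r E).card + 1 := by rw [u1, card_insert_of_notMem hw]
  have hw1 : w ∈ used r E1 := by rw [u1]; exact mem_insert_self _ _
  have hwa : w ≠ a₁ := by rintro rfl; exact hw ha₁
  have ow1 : outdeg E1 w = 0 := by rw [o1, hE.outdeg_eq_zero hw]; simp [hwa]
  obtain ⟨z, hz, hwz, hE2⟩ := hE1.exists_insert hG.joined (x := w) (by omega) hw1 (by omega)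
  have o2 := outdeg_insert (notMem_of_notMem_used (x := w) hz)
  have u2 := used_insert (r := r) E1 w z
  set E2 := insert (w, z) E1 with hE2d
  have c2 : (used r E2).card = (used r E).card + 2 := by rw [u2, card_insert_of_notMem hz, c1]
  have hzw : z ≠ w := by rintro rfl; exact hz hw1
  have hw2 : w ∈ used r E2 := by rw [u2]; exact mem_insert_of_mem hw1
  have hz2 : z ∈ used r E2 := by rw [u2]; exact mem_insert_self _ _
  have hzE : z ∉ used r E := fun h => hz (by rw [u1]; exact mem_insert_of_mem h)
  have oz2 : outdeg E2 z = 0 := by rw [o2, hE1.outdeg_eq_zero hz]; simp [hzw]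
  have ow2 : outdeg E2 w = 1 := by rw [o2, ow1]; simp
  obtain ⟨C, E3, k1, k2, k3, k4, hE3, u3, o3, o3'⟩ := hE2.exists_connect hG hz2 hw2 hzw
    (by omega) (by omega) (q := 2 * h + 2) (by omega) (by omega)
  have c3 : (used r E3).card = (used r E).card + (2 * h + 4) := by
    rw [u3, card_union_of_disjoint, c2, List.toFinset_card_of_nodup k2, k1]
    · omega
    · rw [Finset.disjoint_right]; intro v hv; exact k3 v (by simpa using hv)
  have s02 : used r E ⊆ used r E2 := by
    rw [u2, u1]; exact (subset_insert _ _).trans (subset_insert _ _)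
  have s23 : used r E2 ⊆ used r E3 := by rw [u3]; exact subset_union_left
  -- coordinates on the cycle
  set L := z :: C with hL
  have hLl : L.length = 2 * h + 3 := by simp [hL, k1]
  have hLn : L.Nodup := List.nodup_cons.2 ⟨fun h => k3 z h hz2, k2⟩
  have hLE : ∀ v ∈ L, v ∉ used r E := by
    intro v hv
    rcases List.mem_cons.1 hv with rfl | hv
    · exact hzE
    · exact fun h => k3 v hv (s02 h)
  have hL3 : ∀ v ∈ L, v ∈ used r E3 := by
    intro v hv
    rcases List.mem_cons.1 hv with rfl | hv
    · exact s23 hz2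
    · rw [u3, mem_union]; exact Or.inr (by simpa using hv)
  -- The cycle is `w, c 0, ..., c (2 * h + 2)`. The default `w` is irrelevant, as only indices below
  -- `2 * h + 3` are used.
  set c : ℕ → V := fun i => L.getD i w with hc
  have hcL : ∀ i (hi : i < 2 * h + 3), c i = L[i]'(by omega) := by
    intro i hi
    simp only [hc]
    exact List.getD_eq_getElem _ _ (by omega)
  have hcm : ∀ i < 2 * h + 3, c i ∈ L := fun i hi => by rw [hcL i hi]; exact List.getElem_mem _
  have hcinj : ∀ i < 2 * h + 3, ∀ j < 2 * h + 3, c i = c j → i = j := by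
    intro i hi j hj hij
    rw [hcL i hi, hcL j hj] at hij
    exact (hLn.getElem_inj_iff).1 hij
  have hcsurj : ∀ v ∈ L, ∃ i < 2 * h + 3, v = c i := by
    intro v hv
    obtain ⟨i, hi, rfl⟩ := List.mem_iff_getElem.1 hv
    exact ⟨i, by omega, (hcL i (by omega)).symm⟩
  have hLc : L.IsChain G.Adj := k4.left_of_append
  have hcadj : ∀ i < 2 * h + 2, G.Adj (c i) (c (i + 1)) := by
    intro i hi
    rw [hcL i (by omega), hcL (i + 1) (by omega)]
    exact List.isChain_iff_getElem.1 hLc i (by omega)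
  have hwc0 : G.Adj w (c 0) := by
    rw [hcL 0 (by omega)]; exact hwz
  have hwcl : G.Adj w (c (2 * h + 2)) := by
    have := List.isChain_iff_getElem.1 k4 (2 * h + 2) (by simp [hLl])
    rw [hcL _ (by omega)]
    rw [List.getElem_append_left (by omega)] at this
    simp only [List.getElem_append_right (show L.length ≤ 2 * h + 2 + 1 by omega)] at this
    simpa using this.symm
  -- the connecting paths
  set x : ℕ → V := fun i => c (2 * h + 2 - i) with hx
  have hxL : ∀ i ≤ h, x i ∈ L := fun i hi => hcm _ (by omega)
  have hyL : ∀ i ≤ h, c i ∈ L := fun i hi => hcm _ (by omega)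
  have hfil : ∀ v, ((range h).filter fun i => v = x i ∨ v = c i).card ≤ 1 := by
    intro v
    rw [card_le_one]
    intro i hi j hj
    simp only [mem_filter, mem_range] at hi hj
    obtain ⟨hi, rfl | rfl⟩ := hi <;> obtain ⟨hj, h' | h'⟩ := hj <;>
      have := hcinj _ (by omega) _ (by omega) h' <;> omega
  have od3 : ∀ v, outdeg E3 v ≤ 51 := by
    intro v
    by_cases hv : v ∈ used r E2
    · refine (o3 v hv).trans ?_
      by_cases hvw : v = w
      · subst hvw; split_ifs <;> omega
      · rw [o2, o1]
        by_cases hvz : v = z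
        · subst hvz; rw [hE.outdeg_eq_zero hzE]; simp [hvw]; split_ifs <;> omega
        · have := hod v
          simp [hvw, hvz]; split_ifs <;> omega
    · exact (o3' v hv).trans (by omega)
  obtain ⟨Q, E4, q1, q2, hE4, u4, c4, o4, o4'⟩ := hE3.exists_connect_family hG x c (fun _ => 2 * h)
    (range h) (fun i hi => hL3 _ (hxL i (by simp at hi; omega)))
    (fun i hi => hL3 _ (hyL i (by simp at hi; omega)))
    (fun i hi hxy => by
      simp only [mem_range] at hi
      have := hcinj _ (by omega) _ (by omega) hxy; omega)
    (fun v _ => by have := hfil v; have := od3 v; omega)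
    (fun i _ => le_rfl) (by rw [c3]; simp only [sum_const, card_range, smul_eq_mul]; omega)
  simp only [sum_const, card_range, smul_eq_mul] at c4
  have s34 : used r E3 ⊆ used r E4 := by rw [u4]; exact subset_union_left
  have od4 : ∀ v, outdeg E4 v ≤ 52 := by
    intro v
    by_cases hv : v ∈ used r E3
    · have := o4 v hv; have := hfil v; have := od3 v; omega
    · exact (o4' v hv).trans (by omega)
  -- the tails
  have hLne : ∀ v ∈ used r E, ∀ v' ∈ L, v ≠ v' := by
    rintro v hv v' hv' rfl; exact hLE v hv' hv
  have s04 : used r E ⊆ used r E4 := s02.trans (s23.trans s34)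
  -- The vertex `a₁` enters at `w` and zigzags over all rungs to `c h` or to `x h`, the exits
  -- towards `b₁` and `b₂`. The path from `a₂` arrives at `c (h + 1)` and takes the other exit. Its
  -- tail is long enough to make up for the zigzag.
  obtain ⟨p, hp⟩ : ∃ p : Fin 3 → V, p = ![a₂, b₁, b₂] := ⟨_, rfl⟩
  obtain ⟨p', hp'⟩ : ∃ p : Fin 3 → V, p = ![c (h + 1), c h, x h] := ⟨_, rfl⟩
  have hfil' : ∀ v, ((univ : Finset (Fin 3)).filter fun i => v = p i ∨ v = p' i).card ≤ 3 :=
    fun v => card_le_univ _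
  obtain ⟨T, E5, t1, t2, hE5, u5, c5, o5, o5'⟩ := hE4.exists_connect_family hG
    p p' ![h * (2 * h + 2), 2 * h, 2 * h] univ
    (by intro i _; fin_cases i <;> simp [hp, s04 ha₂, s04 hb₁, s04 hb₂])
    (by
      intro i _
      subst hp hp'
      fin_cases i
      · exact s34 (hL3 _ (hcm _ (by omega)))
      · exact s34 (hL3 _ (hyL h le_rfl))
      · exact s34 (hL3 _ (hxL h le_rfl)))
    (by
      intro i _
      subst hp hp'
      fin_cases i
      · exact hLne _ ha₂ _ (hcm _ (by omega))
      · exact hLne _ hb₁ _ (hyL h le_rfl)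
      · exact hLne _ hb₂ _ (hxL h le_rfl))
    (fun v _ => by have := hfil' v; have := od4 v; omega)
    (by
      intro i _
      fin_cases i
      · simp; nlinarith [Nat.zero_le (h * h)]
      · simp
      · simp)
    (by simp only [Fin.sum_univ_three]; simp; omega)
  simp only [Fin.sum_univ_three, Matrix.cons_val_zero, Matrix.cons_val_one, Matrix.cons_val] at c5
  obtain ⟨l0, -, ch0, -⟩ := t1 0 (mem_univ _)
  obtain ⟨l1, -, ch1, -⟩ := t1 1 (mem_univ _)
  obtain ⟨l2, -, ch2, -⟩ := t1 2 (mem_univ _)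
  simp only [hp, hp', Matrix.cons_val_zero, Matrix.cons_val_one, Matrix.cons_val] at l0 l1 l2 ch0 ch1 ch2
  have hrev : ∀ {a b : V} {l : List V}, (a :: l ++ [b]).IsChain G.Adj →
      (b :: l.reverse ++ [a]).IsChain G.Adj := by
    intro a b l hl
    have : b :: l.reverse ++ [a] = (a :: l ++ [b]).reverse := by simp
    rw [this, List.isChain_reverse]
    exact hl.imp fun _ _ hab => hab.symm
  have hzig : ∀ ε, (a₁ :: zigzag w x c Q ε h ++
      [if xor h.bodd ε then x h else c h]).IsChain G.Adj := by
    intro ε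
    have h1 := zigzag_isChain (G := G) (w := w) (x := x) (y := c) (I := Q) ε (by simpa [hx] using hwcl)
      hwc0 h (fun i hi => (q1 i (mem_range.2 hi)).2.2.1)
      (fun i hi => by
        have := hcadj (2 * h + 2 - (i + 1)) (by omega)
        simp only [hx]
        rw [show 2 * h + 2 - (i + 1) + 1 = 2 * h + 2 - i by omega] at this
        exact this.symm)
      (fun i hi => hcadj i (by omega))
    rw [List.cons_append, List.isChain_cons]
    refine ⟨?_, h1⟩
    intro v hv
    have : ∀ s, (zigzag w x c Q ε s).head? = some w := by
      intro s
      induction s with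
      | zero => rfl
      | succ s ih => rw [zigzag, List.head?_append, ih]; rfl
    rw [List.head?_append, this] at hv
    simp at hv
    exact hv ▸ haw
  have hadjy : G.Adj (c (h + 1)) (c h) := (hcadj h (by omega)).symm
  have hadjx : G.Adj (c (h + 1)) (x h) := by
    have := hcadj (h + 1) (by omega)
    simp only [hx]
    rwa [show 2 * h + 2 - h = h + 1 + 1 by omega]
  have hzl : ∀ ε, (zigzag w x c Q ε h).length = 1 + h * (2 * h + 2) := fun ε =>
    length_zigzag _ _ _ _ _ _ _ fun i hi => (q1 i (mem_range.2 hi)).1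
  set Zy := zigzag w x c Q h.bodd h with hZy
  set Zx := zigzag w x c Q (!h.bodd) h with hZx
  have hperm : Zx.Perm Zy := zigzag_perm _ _ _ _ _ _ _
  have hzy : (a₁ :: Zy ++ [c h]).IsChain G.Adj := by simpa using hzig h.bodd
  have hzx : (a₁ :: Zx ++ [x h]).IsChain G.Adj := by simpa using hzig (!h.bodd)
  set I₁ := Zy ++ c h :: (T 1).reverse with hI₁
  set I₂ := T 0 ++ c (h + 1) :: (x h :: (T 2).reverse) with hI₂
  set J₁ := Zx ++ x h :: (T 2).reverse with hJ₁
  set J₂ := T 0 ++ c (h + 1) :: (c h :: (T 1).reverse) with hJ₂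
  have hlI₁ : I₁.length = 2 * (h + 1) ^ 2 := by simp [hI₁, hzl, hZy, l1]; omega
  have hlI₂ : I₂.length = 2 * (h + 1) ^ 2 := by simp [hI₂, l0, l2]; omega
  have hlJ₁ : J₁.length = 2 * (h + 1) ^ 2 := by simp [hJ₁, hzl, hZx, l2]; omega
  have hlJ₂ : J₂.length = 2 * (h + 1) ^ 2 := by simp [hJ₂, l0, l1]; omega
  -- Disjointness and absence of repetitions are not checked piece by piece: the two lists cover all
  -- new vertices and have the right total length.
  have hcov : used r E5 ⊆ used r E ∪ (I₁ ++ I₂).toFinset := by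
    have hLcov : ∀ v ∈ L, v ∈ I₁ ++ I₂ := by
      intro v hv
      obtain ⟨i, hi, rfl⟩ := hcsurj v hv
      simp only [hI₁, hI₂, List.mem_append, List.mem_cons, hZy, mem_zigzag]
      rcases lt_trichotomy i (h + 1) with hi' | rfl | hi'
      · rcases Nat.lt_succ_iff_lt_or_eq.1 hi' with hi'' | rfl
        · exact Or.inl (Or.inl (Or.inr ⟨i, hi'', Or.inr (Or.inl rfl)⟩))
        · exact Or.inl (Or.inr (Or.inl rfl))
      · exact Or.inr (Or.inr (Or.inl rfl))
      · have hxi : c i = x (2 * h + 2 - i) := by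
          simp only [hx]; congr 1; omega
        by_cases hih : i = h + 2
        · refine Or.inr (Or.inr (Or.inr (Or.inl ?_)))
          rw [hxi]
          exact congrArg x (by omega)
        · exact Or.inl (Or.inl (Or.inr ⟨2 * h + 2 - i, by omega, Or.inl hxi⟩))
    intro v hv
    rw [mem_union, List.mem_toFinset]
    rw [u5, mem_union, mem_biUnion] at hv
    rcases hv with hv | ⟨i, -, hv⟩
    · rw [u4, mem_union, mem_biUnion] at hv
      rcases hv with hv | ⟨i, hi, hv⟩
      · rw [u3, mem_union, u2, mem_insert, u1, mem_insert] at hv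
        rcases hv with (rfl | rfl | hv) | hv
        · exact Or.inr (hLcov _ (by simp [hL]))
        · refine Or.inr ?_
          simp only [hI₁, List.mem_append, hZy, mem_zigzag]
          exact Or.inl (Or.inl (Or.inl trivial))
        · exact Or.inl hv
        · exact Or.inr (hLcov _ (by rw [hL]; exact List.mem_cons_of_mem _ (by simpa using hv)))
      · refine Or.inr ?_
        simp only [hI₁, List.mem_append, hZy, mem_zigzag]
        exact Or.inl (Or.inl (Or.inr ⟨i, mem_range.1 hi, Or.inr (Or.inr (by simpa using hv))⟩))
    · refine Or.inr ?_
      rw [List.mem_toFinset] at hv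
      simp only [hI₁, hI₂, List.mem_append, List.mem_cons, List.mem_reverse]
      fin_cases i
      · exact Or.inr (Or.inl hv)
      · exact Or.inl (Or.inr (Or.inr hv))
      · exact Or.inr (Or.inr (Or.inr (Or.inr hv)))
  obtain ⟨hn1, hn2, hn3⟩ := nodup_of_subset_union hcov (by
    rw [List.length_append, hlI₁, hlI₂, c5, c4, c3]; omega)
  refine ⟨I₁, I₂, J₁, J₂, E5, ⟨hlI₁, hlI₂, hlJ₁, hlJ₂⟩, ⟨isChain_join hzy (hrev ch1), ?_,
    isChain_join hzx (hrev ch2), ?_⟩, hn1, ?_, hn2, hE5, hn3, ?_, ?_⟩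
  · refine isChain_join ch0 ?_
    rw [List.cons_append, List.cons_append, List.isChain_cons_cons]
    exact ⟨hadjx, hrev ch2⟩
  · refine isChain_join ch0 ?_
    rw [List.cons_append, List.cons_append, List.isChain_cons_cons]
    exact ⟨hadjy, hrev ch1⟩
  · rw [List.perm_iff_count]
    intro v
    have := hperm.count_eq v
    simp only [hI₁, hI₂, hJ₁, hJ₂, List.count_append, List.count_cons]
    omega
  · intro v hv
    have hvL : v ∉ L := fun h => hLE v h hv
    have hvw : v ≠ w := by rintro rfl; exact hw hv
    have hvz : v ≠ z := by rintro rfl; exact hzE hv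
    have h3 := o3 v (s02 hv)
    rw [if_neg (by simp [hvz, hvw]), o2, if_neg hvw, o1] at h3
    have h4 := o4 v (s23 (s02 hv))
    rw [filter_eq_empty_iff.2, card_empty] at h4
    · have h5 := o5 v (s04 hv)
      by_cases hvt : v = a₁ ∨ v = a₂ ∨ v = b₁ ∨ v = b₂
      · rw [if_pos hvt]
        have := hfil' v
        split_ifs at h3 <;> omega
      · rw [filter_eq_empty_iff.2, card_empty] at h5
        · rw [if_neg hvt]
          rw [if_neg (by tauto)] at h3
          omega
        · have e1 : v ≠ c (h + 1) := fun h' => hvL (h' ▸ hcm _ (by omega))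
          have e2 : v ≠ c h := fun h' => hvL (h' ▸ hyL _ le_rfl)
          have e3 : v ≠ x h := fun h' => hvL (h' ▸ hxL _ le_rfl)
          push Not at hvt
          intro i _
          fin_cases i
          · simp [hp, hp', hvt, e1]
          · simp [hp, hp', hvt, e2]
          · simp [hp, hp', hvt, e3]
    · intro i hi h'
      have hi := mem_range.1 hi
      rcases h' with h' | h'
      · exact hvL (h' ▸ hxL i hi.le)
      · exact hvL (h' ▸ hyL i hi.le)
  · intro v hv
    by_cases hv4 : v ∈ used r E4
    · have h5 := o5 v hv4
      have := hfil' v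
      -- The bound 6 for new vertices: one child from the edge `wz`, one from closing the cycle, one
      -- from the rungs and at most three from the tails.
      suffices outdeg E4 v ≤ 3 by omega
      by_cases hv3 : v ∈ used r E3
      · have h4 := o4 v hv3
        have := hfil v
        suffices outdeg E3 v ≤ 2 by omega
        by_cases hv2 : v ∈ used r E2
        · have h3 := o3 v hv2
          suffices outdeg E2 v ≤ 1 by split_ifs at h3 <;> omega
          by_cases hvw : v = w
          · subst hvw; omega
          · rw [o2, o1, hE.outdeg_eq_zero hv, if_neg hvw]
            split_ifs <;> omega
        · exact (o3' v hv2).trans (by omega)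
      · exact (o4' v hv3).trans (by omega)
    · exact (o5' v hv4).trans (by omega)

end ExpanderPartition

namespace ExpanderPartition

open Finset
open scoped Classical

variable {V : Type*} [Fintype V] {G : SimpleGraph V} {D m h K : ℕ} {r : V}

/-! ### Layers of switches and linking structures -/

/-- The extension `E'` of the forest `E` adds a set `U` of vertices that, for each setting `τ` of
the layer `μ`, splits into the interiors of paths with `g` interior vertices from `a i` to
`b (τ i)` for `i ∈ s`. -/
structure IsLayer {ι : Type*} (G : SimpleGraph V) (D m : ℕ) (r : V) (g : ℕ) (a b : ι → V)
    (μ : Equiv.Perm ι) (s : Finset ι) (E E' : Finset (V × V)) (U : Finset V) : Prop where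
  isExtendable : IsExtendable G D m r E'
  used_eq : used r E' = used r E ∪ U
  disj : Disjoint (used r E) U
  card_eq : U.card = s.card * g
  outdeg_le : ∀ v ∈ used r E,
    outdeg E' v ≤ outdeg E v + if ∃ i ∈ s, v = a i ∨ v = b i then 4 else 0
  outdeg_new_le : ∀ v ∉ used r E, outdeg E' v ≤ 6
  links : ∀ τ, IsSetting μ τ → ∃ I : ι → List V,
    (∀ i ∈ s, (I i).length = g ∧ (a i :: I i ++ [b (τ i)]).IsChain G.Adj ∧ (I i).Nodup ∧
      ∀ v ∈ I i, v ∈ U) ∧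
    ∀ i ∈ s, ∀ j ∈ s, i ≠ j → (I i).Disjoint (I j)

/-- The second extension gives no children to vertices created by the first, since only terminals
and its own vertices get any; and since `s` and `t` are disjoint, each terminal is charged its 4
children once. -/
lemma IsLayer.union {ι : Type*} {g : ℕ} {a b : ι → V} {μ : Equiv.Perm ι} {s t : Finset ι}
    {E E₁ E₂ : Finset (V × V)} {U₁ U₂ : Finset V} (ha : ∀ i, a i ∈ used r E)
    (hb : ∀ i, b i ∈ used r E) (hainj : Function.Injective a) (hbinj : Function.Injective b)
    (hab : ∀ i j, a i ≠ b j) (h₁ : IsLayer G D m r g a b μ s E E₁ U₁)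
    (h₂ : IsLayer G D m r g a b μ t E₁ E₂ U₂) (hst : Disjoint s t) :
    IsLayer G D m r g a b μ (s ∪ t) E E₂ (U₁ ∪ U₂) := by
  have hsub : used r E ⊆ used r E₁ := by rw [h₁.used_eq]; exact subset_union_left
  have hU : Disjoint U₁ U₂ := by
    refine h₂.disj.mono_left ?_
    rw [h₁.used_eq]; exact subset_union_right
  refine ⟨h₂.isExtendable, ?_, ?_, ?_, ?_, ?_, ?_⟩
  · rw [h₂.used_eq, h₁.used_eq, union_assoc]
  · rw [disjoint_union_right]
    exact ⟨h₁.disj, h₂.disj.mono_left hsub⟩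
  · rw [card_union_of_disjoint hU, card_union_of_disjoint hst, h₁.card_eq, h₂.card_eq]
    ring
  · intro v hv
    have e1 := h₁.outdeg_le v hv
    have e2 := h₂.outdeg_le v (hsub hv)
    by_cases hs : ∃ i ∈ s, v = a i ∨ v = b i
    · have ht : ¬ ∃ i ∈ t, v = a i ∨ v = b i := by
        rintro ⟨j, hj, hvj⟩
        obtain ⟨i, hi, hvi⟩ := hs
        have : i = j := by
          rcases hvi with rfl | rfl <;> rcases hvj with h | h
          · exact hainj h
          · exact absurd h (hab _ _)
          · exact absurd h.symm (hab _ _)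
          · exact hbinj h
        exact Finset.disjoint_left.1 hst hi (this ▸ hj)
      rw [if_pos hs] at e1
      rw [if_neg ht] at e2
      rw [if_pos (hs.imp fun i hi => ⟨mem_union_left _ hi.1, hi.2⟩)]
      omega
    · rw [if_neg hs] at e1
      by_cases ht : ∃ i ∈ t, v = a i ∨ v = b i
      · rw [if_pos ht] at e2
        rw [if_pos (ht.imp fun i hi => ⟨mem_union_right _ hi.1, hi.2⟩)]
        omega
      · rw [if_neg ht] at e2
        omega
  · intro v hv
    by_cases hv1 : v ∈ used r E₁
    · have e1 := h₁.outdeg_new_le v hv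
      have e2 := h₂.outdeg_le v hv1
      rw [if_neg] at e2
      · omega
      · rintro ⟨i, -, rfl | rfl⟩
        · exact hv (ha i)
        · exact hv (hb i)
    · exact h₂.outdeg_new_le v hv1
  · intro τ hτ
    obtain ⟨I, hI, hI'⟩ := h₁.links τ hτ
    obtain ⟨J, hJ, hJ'⟩ := h₂.links τ hτ
    have hnt : ∀ i ∈ t, i ∉ s := fun i hi hi' => Finset.disjoint_left.1 hst hi' hi
    refine ⟨fun i => if i ∈ s then I i else J i, ?_, ?_⟩
    · intro i hi
      rcases mem_union.1 hi with hi | hi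
      · simp only [if_pos hi]
        exact ⟨(hI i hi).1, (hI i hi).2.1, (hI i hi).2.2.1,
          fun v hv => mem_union_left _ ((hI i hi).2.2.2 v hv)⟩
      · simp only [if_neg (hnt i hi)]
        exact ⟨(hJ i hi).1, (hJ i hi).2.1, (hJ i hi).2.2.1,
          fun v hv => mem_union_right _ ((hJ i hi).2.2.2 v hv)⟩
    · intro i hi j hj hij
      rcases mem_union.1 hi with hi | hi <;> rcases mem_union.1 hj with hj | hj
      · simp only [if_pos hi, if_pos hj]; exact hI' i hi j hj hij
      · simp only [if_pos hi, if_neg (hnt j hj)]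
        intro v hv hv'
        exact Finset.disjoint_left.1 hU ((hI i hi).2.2.2 v hv) ((hJ j hj).2.2.2 v hv')
      · simp only [if_pos hj, if_neg (hnt i hi)]
        intro v hv hv'
        exact Finset.disjoint_left.1 hU ((hI j hj).2.2.2 v hv') ((hJ i hi).2.2.2 v hv)
      · simp only [if_neg (hnt i hi), if_neg (hnt j hj)]; exact hJ' i hi j hj hij

/-- A fixed point of `μ` needs only one path; a 2-cycle needs a switch. A setting is trivial or full
on each orbit, so these are all the cases. -/
lemma IsExtendable.exists_isLayer_pair (hG : IsHost G D m h K) {E : Finset (V × V)}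
    (hE : IsExtendable G D m r E) {ι : Type*} {a b : ι → V} {μ : Equiv.Perm ι}
    (hμ : ∀ i, μ (μ i) = i) (ha : ∀ i, a i ∈ used r E) (hb : ∀ i, b i ∈ used r E)
    (hab : ∀ i j, a i ≠ b j) (hod : ∀ v, outdeg E v ≤ 50) (i : ι)
    (hK : (used r E).card + ({i, μ i} : Finset ι).card * (2 * (h + 1) ^ 2) ≤ K) :
    ∃ E' U, IsLayer G D m r (2 * (h + 1) ^ 2) a b μ {i, μ i} E E' U := by
  have hdeg := hG.deg
  by_cases hi : μ i = i
  · rw [hi, pair_eq_singleton, card_singleton, one_mul] at hK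
    obtain ⟨I, E', h1, h2, h3, h4, h5, h6, h7, h8⟩ := hE.exists_connect hG (ha i) (hb i) (hab i i)
      (by have := hod (a i); omega) (by have := hod (b i); omega) (q := 2 * (h + 1) ^ 2)
      (by nlinarith) hK
    refine ⟨E', I.toFinset, h5, h6, ?_, ?_, ?_, ?_, ?_⟩
    · rw [Finset.disjoint_right]; intro v hv; exact h3 v (by simpa using hv)
    · rw [hi, pair_eq_singleton, card_singleton, one_mul, List.toFinset_card_of_nodup h2, h1]
    · intro v hv
      refine (h7 v hv).trans ?_
      simp only [hi, pair_eq_singleton, mem_singleton, exists_eq_left]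
      split_ifs <;> omega
    · exact fun v hv => (h8 v hv).trans (by omega)
    · intro τ hτ
      have hτi : τ i = i := by rcases hτ i with h | h; exacts [h, h.trans hi]
      refine ⟨fun _ => I, ?_, ?_⟩
      · intro j hj
        rw [hi, pair_eq_singleton, mem_singleton] at hj
        subst hj
        exact ⟨h1, by rw [hτi]; exact h4, h2, fun v hv => by simpa using hv⟩
      · intro j hj k hk hjk
        rw [hi, pair_eq_singleton, mem_singleton] at hj hk
        exact absurd (hj.trans hk.symm) hjk
  · have hne : i ≠ μ i := fun h => hi h.symm
    rw [card_pair hne] at hK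
    obtain ⟨I₁, I₂, J₁, J₂, E', ⟨l1, l2, l3, l4⟩, ⟨c1, c2, c3, c4⟩, hn, hp, hd, h5, h6, h7, h8⟩ :=
      hE.exists_switch hG (ha i) (ha (μ i)) (hb i) (hb (μ i)) hod hK
    have hnJ : (J₁ ++ J₂).Nodup := hp.nodup_iff.2 hn
    have hmJ : ∀ v, v ∈ J₁ ++ J₂ ↔ v ∈ I₁ ++ I₂ := fun v => hp.mem_iff
    have key : ∀ (τ : Equiv.Perm ι) (L₁ L₂ : List V), (L₁ ++ L₂).Nodup → (∀ v ∈ L₁ ++ L₂, v ∈ I₁ ++ I₂) →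
        L₁.length = 2 * (h + 1) ^ 2 → L₂.length = 2 * (h + 1) ^ 2 →
        (a i :: L₁ ++ [b (τ i)]).IsChain G.Adj → (a (μ i) :: L₂ ++ [b (τ (μ i))]).IsChain G.Adj →
        ∃ I : ι → List V,
          (∀ j ∈ ({i, μ i} : Finset ι), (I j).length = 2 * (h + 1) ^ 2 ∧
            (a j :: I j ++ [b (τ j)]).IsChain G.Adj ∧ (I j).Nodup ∧
            ∀ v ∈ I j, v ∈ (I₁ ++ I₂).toFinset) ∧
          ∀ j ∈ ({i, μ i} : Finset ι), ∀ k ∈ ({i, μ i} : Finset ι), j ≠ k →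
            (I j).Disjoint (I k) := by
      intro τ L₁ L₂ e1 e2 e3 e4 e5 e6
      rw [List.nodup_append'] at e1
      refine ⟨fun j => if j = i then L₁ else L₂, ?_, ?_⟩
      · intro j hj
        rw [mem_insert, mem_singleton] at hj
        rcases hj with rfl | rfl
        · simp only [if_true]
          exact ⟨e3, e5, e1.1, fun v hv => List.mem_toFinset.2 (e2 v (List.mem_append_left _ hv))⟩
        · simp only [if_neg hi]
          exact ⟨e4, e6, e1.2.1,
            fun v hv => List.mem_toFinset.2 (e2 v (List.mem_append_right _ hv))⟩
      · intro j hj k hk hjk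
        rw [mem_insert, mem_singleton] at hj hk
        rcases hj with rfl | rfl <;> rcases hk with rfl | rfl
        · exact absurd rfl hjk
        · simp only [if_true, if_neg hi]; exact e1.2.2
        · simp only [if_true, if_neg hi]; exact e1.2.2.symm
        · exact absurd rfl hjk
    refine ⟨E', (I₁ ++ I₂).toFinset, h5, h6, ?_, ?_, ?_, h8, ?_⟩
    · rw [Finset.disjoint_right]; intro v hv; exact hd v (by simpa using hv)
    · rw [card_pair hne, List.toFinset_card_of_nodup hn, List.length_append, l1, l2]; ring
    · intro v hv
      refine (h7 v hv).trans (Nat.add_le_add_left ?_ _)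
      split_ifs with e1 e2 <;> try omega
      apply absurd _ e2
      simp only [mem_insert, mem_singleton, exists_eq_or_imp, exists_eq_left]
      tauto
    · intro τ hτ
      rcases hτ i with h1 | h1
      · have h2 : τ (μ i) = μ i := by
          rcases hτ (μ i) with h2 | h2
          · exact h2
          · rw [hμ] at h2
            exact absurd (τ.injective (h2.trans h1.symm)) hi
        exact key τ I₁ I₂ hn (fun v hv => hv) l1 l2 (by rw [h1]; exact c1) (by rw [h2]; exact c2)
      · have h2 : τ (μ i) = i := by
          rcases hτ (μ i) with h2 | h2
          · exact absurd (τ.injective (h2.trans h1.symm)) hi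
          · rw [h2, hμ]
        exact key τ J₁ J₂ hnJ (fun v hv => (hmJ v).1 hv) l3 l4 (by rw [h1]; exact c3)
          (by rw [h2]; exact c4)

/-- The orbits of `μ` are split off one by one. The slack between 40 and the bound 50 for a switch
absorbs the children already added in this layer. -/
lemma IsExtendable.exists_isLayer (hG : IsHost G D m h K) {E : Finset (V × V)}
    (hE : IsExtendable G D m r E) {ι : Type*} {a b : ι → V} {μ : Equiv.Perm ι}
    (hμ : ∀ i, μ (μ i) = i) (ha : ∀ i, a i ∈ used r E) (hb : ∀ i, b i ∈ used r E)
    (hainj : Function.Injective a) (hbinj : Function.Injective b)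
    (hab : ∀ i j, a i ≠ b j) (hod : ∀ v, outdeg E v ≤ 40) (s : Finset ι)
    (hs : ∀ i ∈ s, μ i ∈ s) (hK : (used r E).card + s.card * (2 * (h + 1) ^ 2) ≤ K) :
    ∃ E' U, IsLayer G D m r (2 * (h + 1) ^ 2) a b μ s E E' U := by
  induction s using Finset.strongInduction with
  | H s ih =>
    rcases s.eq_empty_or_nonempty with rfl | ⟨i, hi⟩
    · exact ⟨E, ∅, hE, by simp, by simp, by simp, by simp,
        fun v hv => by simp [hE.outdeg_eq_zero hv], fun τ _ => ⟨fun _ => [], by simp, by simp⟩⟩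
    · have hpair : ({i, μ i} : Finset ι) ⊆ s := by
        intro j hj
        rw [mem_insert, mem_singleton] at hj
        rcases hj with rfl | rfl
        exacts [hi, hs i hi]
      have hdisj : Disjoint (s \ {i, μ i}) ({i, μ i} : Finset ι) := sdiff_disjoint
      have hun : s \ {i, μ i} ∪ {i, μ i} = s := sdiff_union_of_subset hpair
      have hcard : (s \ {i, μ i}).card * (2 * (h + 1) ^ 2) +
          ({i, μ i} : Finset ι).card * (2 * (h + 1) ^ 2) = s.card * (2 * (h + 1) ^ 2) := by
        rw [← add_mul, ← card_union_of_disjoint hdisj, hun]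
      obtain ⟨E₁, U₁, h₁⟩ := ih (s \ {i, μ i})
        (sdiff_ssubset hpair ⟨i, mem_insert_self _ _⟩)
        (by
          intro j hj
          simp only [mem_sdiff, mem_insert, mem_singleton, not_or] at hj ⊢
          refine ⟨hs j hj.1, fun h => hj.2.2 ?_, fun h => hj.2.1 (μ.injective h)⟩
          rw [← h, hμ])
        (by omega)
      have hsub : used r E ⊆ used r E₁ := by rw [h₁.used_eq]; exact subset_union_left
      obtain ⟨E₂, U₂, h₂⟩ := h₁.isExtendable.exists_isLayer_pair hG hμ (fun i => hsub (ha i))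
        (fun i => hsub (hb i)) hab
        (fun v => by
          by_cases hv : v ∈ used r E
          · have e1 := h₁.outdeg_le v hv
            have e2 := hod v
            split_ifs at e1 <;> omega
          · exact (h₁.outdeg_new_le v hv).trans (by omega)) i
        (by rw [h₁.used_eq, card_union_of_disjoint h₁.disj, h₁.card_eq]; omega)
      have := h₁.union ha hb hainj hbinj hab h₂ hdisj
      rw [hun] at this
      exact ⟨_, _, this⟩

/-- Each vertex of a family can be given a new child. -/
lemma IsExtendable.exists_children (hG : IsHost G D m h K) {E : Finset (V × V)}
    (hE : IsExtendable G D m r E) {ι : Type*} {a : ι → V} (hainj : Function.Injective a)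
    (ha : ∀ i, a i ∈ used r E) (hod : ∀ i, outdeg E (a i) < D) (s : Finset ι)
    (hK : (used r E).card + s.card ≤ K) :
    ∃ (b : ι → V) (E' : Finset (V × V)), IsExtendable G D m r E' ∧
      Set.InjOn b s ∧ (∀ i ∈ s, b i ∉ used r E) ∧ used r E' = used r E ∪ s.image b ∧
      (∀ v, outdeg E' v ≤ outdeg E v + if ∃ i ∈ s, v = a i then 1 else 0) := by
  induction s using Finset.induction_on with
  | empty => exact ⟨a, E, hE, by simp, by simp, by simp, by simp⟩
  | insert i s hi ih =>
    rw [card_insert_of_notMem hi] at hK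
    obtain ⟨b, E₁, e1, e2, e3, e4, e5⟩ := ih (by omega)
    have hroom := hG.room
    have hpow := Nat.one_le_two_pow (n := h + 2)
    have hc : (used r E₁).card ≤ (used r E).card + s.card := by
      rw [e4]
      exact (card_union_le _ _).trans (Nat.add_le_add_left card_image_le _)
    have hsub : used r E ⊆ used r E₁ := by rw [e4]; exact subset_union_left
    have hni : ¬ ∃ j ∈ s, a i = a j := by
      rintro ⟨j, hj, hij⟩
      exact hi (hainj hij ▸ hj)
    obtain ⟨y, hy, -, hE2⟩ := e1.exists_insert hG.joined (x := a i) (by omega) (hsub (ha i)) (by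
      have := e5 (a i)
      rw [if_neg hni] at this
      exact lt_of_le_of_lt this (hod i))
    have hne : ∀ j ∈ s, j ≠ i := fun j hj h => hi (h ▸ hj)
    have hbs : ∀ j ∈ s, b j ∈ used r E₁ := by
      intro j hj
      rw [e4]
      exact mem_union_right _ (mem_image_of_mem b hj)
    refine ⟨Function.update b i y, _, hE2, ?_, ?_, ?_, ?_⟩
    · intro j hj k hk hjk
      rcases mem_insert.1 (mem_coe.1 hj) with hj' | hj' <;>
        rcases mem_insert.1 (mem_coe.1 hk) with hk' | hk'
      · exact hj'.trans hk'.symm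
      · rw [hj', Function.update_self, Function.update_of_ne (hne k hk')] at hjk
        exact absurd (hjk ▸ hbs k hk') hy
      · rw [hk', Function.update_self, Function.update_of_ne (hne j hj')] at hjk
        exact absurd (hjk ▸ hbs j hj') hy
      · rw [Function.update_of_ne (hne j hj'), Function.update_of_ne (hne k hk')] at hjk
        exact e2 hj' hk' hjk
    · intro j hj
      rcases mem_insert.1 hj with rfl | hj
      · rw [Function.update_self]; exact fun h => hy (hsub h)
      · rw [Function.update_of_ne (hne j hj)]; exact e3 j hj
    · have : s.image (Function.update b i y) = s.image b :=
        image_congr fun j hj => Function.update_of_ne (hne j hj) _ _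
      rw [used_insert, e4, image_insert, Function.update_self, this, union_insert]
    · intro v
      rw [outdeg_insert (notMem_of_notMem_used hy)]
      have e := e5 v
      by_cases hv : v = a i
      · rw [if_pos hv, if_pos ⟨i, mem_insert_self _ _, hv⟩]
        rw [hv, if_neg hni] at e
        rw [hv]; omega
      · rw [if_neg hv]
        refine e.trans (Nat.add_le_add_left ?_ _)
        split_ifs with h1 h2 <;> try omega
        exact absurd (h1.imp fun j hj => ⟨mem_insert_of_mem hj.1, hj.2⟩) h2

/-- A switching network can be built into the graph. -/
lemma IsExtendable.exists_network (hG : IsHost G D m h K) {ι : Type*} [Fintype ι]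
    (ms : List (Equiv.Perm ι)) (hms : ∀ μ ∈ ms, ∀ i, μ (μ i) = i) :
    ∀ (E : Finset (V × V)) (a : ι → V), IsExtendable G D m r E → Function.Injective a →
      (∀ i, a i ∈ used r E) → (∀ v, outdeg E v ≤ 9) → (∀ i, outdeg E (a i) ≤ 4) →
      (used r E).card + Fintype.card ι * (2 * (h + 1) ^ 2 + 1) * ms.length ≤ K →
    ∃ (E' : Finset (V × V)) (b : ι → V) (U : Finset V), IsExtendable G D m r E' ∧
      used r E' = used r E ∪ U ∧ Disjoint (used r E) U ∧
      U.card = Fintype.card ι * (2 * (h + 1) ^ 2 + 1) * ms.length ∧ Function.Injective b ∧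
      (∀ i, b i ∈ used r E') ∧ (∀ v, outdeg E' v ≤ 9) ∧ (ms ≠ [] → ∀ i, b i ∈ U) ∧
      ∀ σ, Realizes ms σ → ∃ P : ι → List V,
        (∀ i, (P i).length = (2 * (h + 1) ^ 2 + 1) * ms.length ∧ (a i :: P i).IsChain G.Adj ∧
          (P i).Nodup ∧ (∀ v ∈ P i, v ∈ U) ∧ (a i :: P i).getLast (by simp) = b (σ i)) ∧
        ∀ i j, i ≠ j → (P i).Disjoint (P j) := by
  have hdeg := hG.deg
  induction ms with
  | nil =>
    intro E a hE hainj ha hod _ _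
    refine ⟨E, a, ∅, hE, by simp, by simp, by simp, hainj, ha, hod, by simp, ?_⟩
    intro σ hσ
    simp only [Realizes] at hσ
    subst hσ
    exact ⟨fun _ => [], by simp, by simp⟩
  | cons μ ms ih =>
    intro E a hE hainj ha hod hoda hK
    set g := 2 * (h + 1) ^ 2 with hg
    set n := Fintype.card ι with hn
    have hlen : n * (g + 1) * (μ :: ms).length = n + n * g + n * (g + 1) * ms.length := by
      rw [List.length_cons]; ring
    rw [hlen] at hK
    -- Fresh terminals for the next stage. They are children of the `a i` only to be part of the
    -- forest; the routing does not use these edges. The degree invariants survive: `a i` has at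
    -- most `4 + 1 + 4 = 9` children, `b i` at most 4, and other new vertices at most 6.
    obtain ⟨b, E₁, hE₁, b1, b2, u1, o1⟩ := hE.exists_children hG hainj ha
      (fun i => by have := hoda i; omega) univ (by rw [card_univ]; omega)
    have hbinj : Function.Injective b := fun i j hij => b1 (by simp) (by simp) hij
    have hbnew : ∀ i, b i ∉ used r E := fun i => b2 i (mem_univ i)
    have hsub1 : used r E ⊆ used r E₁ := by rw [u1]; exact subset_union_left
    have hb1 : ∀ i, b i ∈ used r E₁ := fun i => by
      rw [u1]; exact mem_union_right _ (mem_image_of_mem b (mem_univ i))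
    have hdis1 : Disjoint (used r E) (univ.image b) := by
      rw [Finset.disjoint_right]
      intro v hv
      obtain ⟨i, -, rfl⟩ := mem_image.1 hv
      exact hbnew i
    have hcb : (univ.image b).card = n := by rw [card_image_of_injective _ hbinj, card_univ]
    have hab : ∀ i j, a i ≠ b j := fun i j hij => hbnew j (hij ▸ ha i)
    have c1 : (used r E₁).card = (used r E).card + n := by
      rw [u1, card_union_of_disjoint hdis1, hcb]
    have hob : ∀ i, outdeg E₁ (b i) = 0 := by
      intro i
      have := o1 (b i)
      rw [hE.outdeg_eq_zero (hbnew i), if_neg] at this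
      · omega
      · rintro ⟨j, -, hj⟩; exact hab j i hj.symm
    have hoa : ∀ i, outdeg E₁ (a i) ≤ 5 := by
      intro i
      have e1 := o1 (a i)
      have e2 := hoda i
      split_ifs at e1 <;> omega
    have ho1 : ∀ v, (¬ ∃ i, v = a i) → outdeg E₁ v ≤ 9 := by
      intro v hv
      have e1 := o1 v
      rw [if_neg (fun ⟨i, _, hi⟩ => hv ⟨i, hi⟩)] at e1
      exact e1.trans (hod v)
    obtain ⟨E₂, U₂, hl⟩ := hE₁.exists_isLayer hG (hms μ (by simp)) (fun i => hsub1 (ha i)) hb1 hainj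
      hbinj hab
      (fun v => by
        by_cases hv : ∃ i, v = a i
        · obtain ⟨i, rfl⟩ := hv
          exact (hoa i).trans (by omega)
        · exact (ho1 v hv).trans (by omega)) univ (fun i _ => mem_univ _)
      (by rw [c1, card_univ, ← hn, ← hg]; omega)
    have hcU2 : U₂.card = n * g := by rw [hl.card_eq, card_univ]
    have c2 : (used r E₂).card = (used r E).card + n + n * g := by
      rw [hl.used_eq, card_union_of_disjoint hl.disj, c1, hcU2]
    have hsub2 : used r E₁ ⊆ used r E₂ := by rw [hl.used_eq]; exact subset_union_left
    have hob2 : ∀ i, outdeg E₂ (b i) ≤ 4 := by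
      intro i
      have := hl.outdeg_le (b i) (hb1 i)
      rw [hob i] at this
      split_ifs at this <;> omega
    have ho2 : ∀ v, outdeg E₂ v ≤ 9 := by
      intro v
      by_cases hv1 : v ∈ used r E₁
      · have e1 := hl.outdeg_le v hv1
        by_cases hva : ∃ i, v = a i
        · obtain ⟨i, rfl⟩ := hva
          have := hoa i
          split_ifs at e1 <;> omega
        · by_cases hvb : ∃ i, v = b i
          · obtain ⟨i, rfl⟩ := hvb
            exact (hob2 i).trans (by omega)
          · rw [if_neg] at e1
            · exact e1.trans (ho1 v hva)
            · rintro ⟨i, -, h | h⟩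
              exacts [hva ⟨i, h⟩, hvb ⟨i, h⟩]
      · exact (hl.outdeg_new_le v hv1).trans (by omega)
    obtain ⟨E₃, b', U₃, hE₃, u3, d3, c3, hbinj', hb', ho3, hbU, hP⟩ := ih
      (fun ν hν => hms ν (List.mem_cons_of_mem _ hν)) E₂ b hl.isExtendable hbinj
      (fun i => hsub2 (hb1 i)) ho2 hob2 (by rw [c2]; omega)
    have hB2 : Disjoint (univ.image b) U₂ := by
      refine hl.disj.mono_left ?_
      rw [u1]; exact subset_union_right
    have hB3 : Disjoint (univ.image b ∪ U₂) U₃ := by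
      refine d3.mono_left ?_
      rw [hl.used_eq, u1, union_assoc]; exact subset_union_right
    refine ⟨E₃, b', univ.image b ∪ U₂ ∪ U₃, hE₃, ?_, ?_, ?_, hbinj', hb', ho3, ?_, ?_⟩
    · rw [u3, hl.used_eq, u1]; simp only [union_assoc]
    · rw [disjoint_union_right, disjoint_union_right]
      exact ⟨⟨hdis1, hl.disj.mono_left hsub1⟩, d3.mono_left (hsub1.trans hsub2)⟩
    · rw [card_union_of_disjoint hB3, card_union_of_disjoint hB2, hcb, hcU2, c3, hlen]
    · intro _ i
      rcases eq_or_ne ms [] with rfl | hne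
      -- With no layers left, routing the identity through the empty network shows that its outputs
      -- are its inputs `b`.
      · obtain ⟨P, hP1, -⟩ := hP 1 rfl
        obtain ⟨p1, -, -, -, p2⟩ := hP1 i
        have : P i = [] := by simpa using p1
        simp only [this, List.getLast_singleton, Equiv.Perm.one_apply] at p2
        rw [← p2]
        exact mem_union_left _ (mem_union_left _ (mem_image_of_mem b (mem_univ i)))
      · exact mem_union_right _ (hbU hne i)
    · rintro σ ⟨τ, ρ, hτ, hρ, rfl⟩
      obtain ⟨I, hI, hI'⟩ := hl.links τ hτ
      obtain ⟨P, hP1, hP2⟩ := hP ρ hρ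
      have hmB : ∀ i, b i ∈ univ.image b := fun i => mem_image_of_mem b (mem_univ i)
      have hBI : ∀ i j, b i ∉ I j := fun i j hij =>
        Finset.disjoint_left.1 hB2 (hmB i) ((hI j (mem_univ j)).2.2.2 _ hij)
      have hBP : ∀ i j, b i ∉ P j := fun i j hij =>
        Finset.disjoint_left.1 hB3 (mem_union_left _ (hmB i)) ((hP1 j).2.2.2.1 _ hij)
      have hIP : ∀ i j, (I i).Disjoint (P j) := fun i j v hv hv' =>
        Finset.disjoint_left.1 hB3 (mem_union_right _ ((hI i (mem_univ i)).2.2.2 v hv))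
          ((hP1 j).2.2.2.1 _ hv')
      refine ⟨fun i => I i ++ b (τ i) :: P (τ i), ?_, ?_⟩
      · intro i
        obtain ⟨i1, i2, i3, i4⟩ := hI i (mem_univ i)
        obtain ⟨p1, p2, p3, p4, p5⟩ := hP1 (τ i)
        refine ⟨?_, ?_, ?_, ?_, ?_⟩
        · simp only [List.length_append, List.length_cons, i1, p1]; ring
        · rw [← List.cons_append, List.isChain_split]
          exact ⟨i2, p2⟩
        · rw [List.nodup_append', List.nodup_cons]
          refine ⟨i3, ⟨hBP _ _, p3⟩, ?_⟩
          rw [List.disjoint_cons_right]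
          exact ⟨hBI _ _, hIP _ _⟩
        · intro v hv
          rw [List.mem_append, List.mem_cons] at hv
          rcases hv with hv | rfl | hv
          · exact mem_union_left _ (mem_union_right _ (i4 v hv))
          · exact mem_union_left _ (mem_union_left _ (hmB _))
          · exact mem_union_right _ (p4 v hv)
        · have : (a i :: (I i ++ b (τ i) :: P (τ i))).getLast (by simp) =
              (b (τ i) :: P (τ i)).getLast (by simp) := by
            rw [List.getLast_cons (by simp), List.getLast_append_of_right_ne_nil _ _ (by simp)]
          rw [this, p5]; rfl
      · intro i j hij
        have hτij : τ i ≠ τ j := fun h => hij (τ.injective h)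
        intro v hv hv'
        rw [List.mem_append, List.mem_cons] at hv hv'
        rcases hv with hv | hv | hv <;> rcases hv' with hv' | hv' | hv'
        · exact hI' i (mem_univ i) j (mem_univ j) hij hv hv'
        · exact hBI _ _ (hv' ▸ hv)
        · exact hIP _ _ hv hv'
        · exact hBI _ _ (hv ▸ hv')
        · exact hτij (hbinj (hv.symm.trans hv'))
        · exact hBP _ _ (hv ▸ hv')
        · exact hIP _ _ hv' hv
        · exact hBP _ _ (hv' ▸ hv)
        · exact hP2 _ _ hτij hv hv'

end ExpanderPartition

namespace ExpanderPartition

open Finset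
open scoped Classical

variable {V : Type*} {G : SimpleGraph V}

/-! ### Construction of the partition -/

lemma exists_walk_induce {W : Set V} (l : List V) : ∀ (x y : W), ((x : V) :: l).IsChain G.Adj →
    (∀ v ∈ l, v ∈ W) → ((x : V) :: l).getLast (by simp) = y →
    ∃ p : (G.induce W).Walk x y, p.support.map Subtype.val = (x : V) :: l := by
  induction l with
  | nil =>
    intro x y _ _ h
    obtain rfl : x = y := Subtype.ext (by simpa using h)
    exact ⟨.nil, by simp⟩
  | cons z l ih =>
    intro x y hc hW h
    rw [List.isChain_cons_cons] at hc
    obtain ⟨p, hp⟩ := ih ⟨z, hW z (by simp)⟩ y hc.2 (fun v hv => hW v (by simp [hv]))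
      (by simpa using h)
    exact ⟨.cons (by simpa using hc.1) p, by simp [hp]⟩

variable [Fintype V] {D m h K : ℕ} {r : V}

/-- Provides the `N + 1` vertices, of outdegree at most one, from which the input terminals are
taken. That they lie on a path is of no importance. -/
lemma IsExtendable.exists_line (hG : IsHost G D m h K) (h0 : IsExtendable G D m r ∅) (N : ℕ)
    (hN : N + 1 ≤ K) : ∃ (E : Finset (V × V)) (x : V) (l : List V), IsExtendable G D m r E ∧
      (x :: l).Nodup ∧ l.length = N ∧ used r E = (x :: l).toFinset ∧ (∀ v, outdeg E v ≤ 1) ∧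
      outdeg E x = 0 := by
  induction N with
  | zero => exact ⟨∅, r, [], h0, by simp, by simp, by simp [used], by simp [outdeg], by simp [outdeg]⟩
  | succ N ih =>
    obtain ⟨E, x, l, e1, e2, e3, e4, e5, e6⟩ := ih (by omega)
    have hroom := hG.room
    have hdeg := hG.deg
    have hpow := Nat.one_le_two_pow (n := h + 2)
    have hc : (used r E).card = N + 1 := by
      rw [e4, List.toFinset_card_of_nodup e2, List.length_cons, e3]
    obtain ⟨y, hy, -, hE⟩ := e1.exists_insert hG.joined (x := x) (by omega)
      (by rw [e4]; simp) (by omega)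
    have o := outdeg_insert (notMem_of_notMem_used (x := x) hy)
    have hyx : y ≠ x := by rintro rfl; exact hy (by rw [e4]; simp)
    refine ⟨_, y, x :: l, hE, ?_, by simp [e3], ?_, ?_, ?_⟩
    · rw [List.nodup_cons]
      refine ⟨fun h => hy ?_, e2⟩
      rw [e4]; exact List.mem_toFinset.2 h
    · rw [used_insert, e4, ← List.toFinset_cons]
    · intro v
      rw [o]
      by_cases hv : v = x
      · rw [hv, e6]; simp
      · simpa [hv] using e5 v
    · rw [o, e1.outdeg_eq_zero hy]; simp [hyx]

/-- The combinatorial core: a linking structure on the vertices of an extendable forest `E`, and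
paths between its two sides in an extendable forest `E'` containing `E`. -/
lemma exists_linking_forest (hG : IsHost G D m h K) (h0 : IsExtendable G D m r ∅) {N k c : ℕ}
    (hN : 1 ≤ N) (hc : 1 ≤ c) (hNc : N ≤ 2 ^ c) (hk : 2 * h + 2 ≤ k)
    (hK : N + N * (2 * (h + 1) ^ 2 + 1) * (2 * c) + N * (k - 2) ≤ K) :
    ∃ (E E' : Finset (V × V)) (A B : Set V), IsExtendable G D m r E ∧ IsExtendable G D m r E' ∧
      (∀ v, outdeg E v ≤ 9) ∧ (∀ v, outdeg E' v ≤ 11) ∧ used r E ⊆ used r E' ∧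
      (used r E').card ≤ K ∧ A ⊆ used r E ∧ B ⊆ used r E ∧ Disjoint A B ∧
      IsLinkingStructure (G.induce (used r E : Set V)) ((↑) ⁻¹' A) ((↑) ⁻¹' B) ∧
      A.ncard = N ∧ B.ncard = N ∧
      ∃ F : LinearForest (G.induce (((used r E' : Set V) \ used r E) ∪ A ∪ B)) N,
        F.IsSpanning ∧ (∀ i, F.size i = k) ∧ ∀ v ∈ F.ends, (v : V) ∈ A ∪ B := by
  have hdeg := hG.deg
  obtain ⟨E₀, x, l, e1, e2, e3, e4, e5, -⟩ := h0.exists_line hG (N - 1) (by omega)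
  have hlen : (x :: l).length = N := by simp [e3]; omega
  set L := x :: l with hL
  set a : Fin N → V := fun i => L.get (i.cast hlen.symm) with ha
  have hainj : Function.Injective a := by
    intro i j hij
    have := List.nodup_iff_injective_get.1 e2 hij
    simpa [Fin.ext_iff] using this
  have hau : ∀ v, v ∈ used r E₀ ↔ ∃ i, a i = v := by
    intro v
    rw [e4, List.mem_toFinset, List.mem_iff_get]
    constructor
    · rintro ⟨i, rfl⟩
      exact ⟨i.cast hlen, by simp [ha]⟩
    · rintro ⟨i, rfl⟩
      exact ⟨_, rfl⟩
  obtain ⟨ms, hms, hms'⟩ := exists_isRearrangeable_fin c N hNc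
  have hcE₀ : (used r E₀).card = N := by rw [e4, List.toFinset_card_of_nodup e2, hlen]
  obtain ⟨E, b, U, n1, n2, n3, n4, n5, n6, n7, n8, n9⟩ := IsExtendable.exists_network hG ms
    hms'.involutive E₀ a e1 hainj (fun i => (hau _).2 ⟨i, rfl⟩) (fun v => (e5 v).trans (by omega))
    (fun i => (e5 _).trans (by omega)) (by rw [hcE₀, Fintype.card_fin, hms]; omega)
  rw [Fintype.card_fin, hms] at n4
  have hmsne : ms ≠ [] := by rintro rfl; simp at hms; omega
  have hbU := n8 hmsne
  have haE₀ : ∀ i, a i ∈ used r E₀ := fun i => (hau _).2 ⟨i, rfl⟩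
  have haE : ∀ i, a i ∈ used r E := fun i => by rw [n2]; exact mem_union_left _ (haE₀ i)
  have hab : ∀ i j, a i ≠ b j := fun i j hij =>
    Finset.disjoint_left.1 n3 (haE₀ i) (hij ▸ hbU j)
  have hcE : (used r E).card = N + N * (2 * (h + 1) ^ 2 + 1) * (2 * c) := by
    rw [n2, card_union_of_disjoint n3, hcE₀, n4]
  have hfil : ∀ v, ((univ : Finset (Fin N)).filter fun i => v = a i ∨ v = b i).card ≤ 2 := by
    intro v
    rw [filter_or]
    refine (card_union_le _ _).trans (Nat.add_le_add (card_le_one.2 ?_) (card_le_one.2 ?_) :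
      _ ≤ 1 + 1)
    · intro i hi j hj
      simp only [mem_filter] at hi hj
      exact hainj (hi.2.symm.trans hj.2)
    · intro i hi j hj
      simp only [mem_filter] at hi hj
      exact n5 (hi.2.symm.trans hj.2)
  -- The paths of the linear forest, pairing `a i` with `b i`; with their endpoints they have `k`
  -- vertices. A vertex is an endpoint at most twice in the count, which raises the outdegree bound
  -- from 9 to 11.
  obtain ⟨I, E', f1, f2, f3, f4, f5, f6, f7⟩ := n1.exists_connect_family hG a b (fun _ => k - 2) univ
    (fun i _ => haE i) (fun i _ => n6 i) (fun i _ => hab i i)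
    (fun v _ => by have := hfil v; have := n7 v; omega) (fun _ _ => by omega)
    (by rw [hcE, sum_const, card_univ, Fintype.card_fin, smul_eq_mul]; exact hK)
  rw [hcE, sum_const, card_univ, Fintype.card_fin, smul_eq_mul] at f5
  set A : Set V := Set.range a with hA
  set B : Set V := Set.range b with hB
  have hAE : A ⊆ used r E := by rintro _ ⟨i, rfl⟩; exact haE i
  have hBE : B ⊆ used r E := by rintro _ ⟨i, rfl⟩; exact n6 i
  have hABd : Disjoint A B := by
    rw [Set.disjoint_left]
    rintro _ ⟨i, rfl⟩ ⟨j, hj⟩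
    exact hab i j hj.symm
  have hncA : A.ncard = N := by
    rw [hA, ← Set.image_univ, Set.ncard_image_of_injective _ hainj, Set.ncard_univ]; simp
  have hncB : B.ncard = N := by
    rw [hB, ← Set.image_univ, Set.ncard_image_of_injective _ n5, Set.ncard_univ]; simp
  refine ⟨E, E', A, B, n1, f3, n7, ?_, by rw [f4]; exact subset_union_left, by omega, hAE, hBE,
    hABd, ?_, hncA, hncB, ?_⟩
  · intro v
    by_cases hv : v ∈ used r E
    · have := f6 v hv; have := hfil v; have := n7 v; omega
    · exact (f7 v hv).trans (by omega)
  · refine ⟨hABd.preimage _, ?_, ?_⟩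
    · rw [Set.ncard_preimage_of_injective_subset_range Subtype.val_injective (by simpa using hAE),
        Set.ncard_preimage_of_injective_subset_range Subtype.val_injective (by simpa using hBE),
        hncA, hncB]
    · intro φ
      let X : Set V := (used r E : Set V)
      let eA : Fin N ≃ ((↑) ⁻¹' A : Set X) := Equiv.ofBijective
        (fun i => ⟨⟨a i, haE i⟩, ⟨i, rfl⟩⟩)
        ⟨fun i j hij =>
          hainj (congrArg (fun z : ((↑) ⁻¹' A : Set X) => (z.1.1 : V)) hij), by
          rintro ⟨⟨v, hv⟩, ⟨i, hi⟩⟩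
          exact ⟨i, Subtype.ext (Subtype.ext hi)⟩⟩
      let eB : Fin N ≃ ((↑) ⁻¹' B : Set X) := Equiv.ofBijective
        (fun i => ⟨⟨b i, n6 i⟩, ⟨i, rfl⟩⟩)
        ⟨fun i j hij =>
          n5 (congrArg (fun z : ((↑) ⁻¹' B : Set X) => (z.1.1 : V)) hij), by
          rintro ⟨⟨v, hv⟩, ⟨i, hi⟩⟩
          exact ⟨i, Subtype.ext (Subtype.ext hi)⟩⟩
      have heA : ∀ i, ((eA i : X) : V) = a i := fun i => rfl
      have heB : ∀ i, ((eB i : X) : V) = b i := fun i => rfl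
      obtain ⟨P, hP, hP'⟩ := n9 ((eA.trans φ).trans eB.symm) (hms'.realizes _)
      have hPE : ∀ i, ∀ v ∈ P i, v ∈ X := fun i v hv => by
        change v ∈ ((used r E : Finset V) : Set V)
        rw [n2]; exact mem_coe.2 (mem_union_right _ ((hP i).2.2.2.1 v hv))
      have hw : ∀ i, ∃ p : (G.induce X).Walk (eA i : X) (φ (eA i) : X),
          p.support.map Subtype.val = a i :: P i := by
        intro i
        refine exists_walk_induce (P i) _ _ (hP i).2.1 (hPE i) ?_
        rw [← eB.apply_symm_apply (φ (eA i)), heB]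
        exact (hP i).2.2.2.2
      have hw' : ∀ x : ((↑) ⁻¹' A : Set X), ∃ p : (G.induce X).Walk (x : X) (φ x : X),
          p.support.map Subtype.val = a (eA.symm x) :: P (eA.symm x) := by
        intro x
        obtain ⟨i, rfl⟩ := eA.surjective x
        rw [eA.symm_apply_apply]
        exact hw i
      choose p hp using hw'
      have hmem : ∀ x (v : X), v ∈ (p x).support ↔
          (v : V) ∈ a (eA.symm x) :: P (eA.symm x) := by
        intro x v
        rw [← hp x, List.mem_map_of_injective Subtype.val_injective]
      have haP : ∀ i j, a i ∉ P j := fun i j hij =>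
        Finset.disjoint_left.1 n3 (haE₀ i) ((hP j).2.2.2.1 _ hij)
      have hnodup : ∀ i, (a i :: P i).Nodup := fun i =>
        List.nodup_cons.2 ⟨haP i i, (hP i).2.2.1⟩
      have hdis : ∀ i j, i ≠ j → List.Disjoint (a i :: P i) (a j :: P j) := by
        intro i j hij v hv hv'
        rw [List.mem_cons] at hv hv'
        rcases hv with hv | hv <;> rcases hv' with hv' | hv'
        · exact hij (hainj (hv.symm.trans hv'))
        · exact haP _ _ (hv ▸ hv')
        · exact haP _ _ (hv' ▸ hv)
        · exact hP' i j hij hv hv'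
      refine ⟨(2 * (h + 1) ^ 2 + 1) * ms.length, p, ?_, ?_, ?_, ?_⟩
      · intro x
        rw [SimpleGraph.Walk.isPath_def]
        refine List.Nodup.of_map Subtype.val ?_
        rw [hp]; exact hnodup _
      · intro x
        have := congrArg List.length (hp x)
        rw [List.length_map, SimpleGraph.Walk.length_support, List.length_cons,
          (hP _).1] at this
        omega
      · intro x y hxy v hv hv'
        rw [hmem] at hv hv'
        exact hdis _ _ (fun h => hxy (eA.symm.injective h)) hv hv'
      -- The paths cover the whole network by counting: they are disjoint, and their total size does
      -- not depend on the permutation.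
      · have hcov : (univ.biUnion fun i => (a i :: P i).toFinset) = used r E := by
          refine eq_of_subset_of_card_le ?_ ?_
          · intro v hv
            obtain ⟨i, -, hv⟩ := mem_biUnion.1 hv
            rw [List.mem_toFinset, List.mem_cons] at hv
            rcases hv with rfl | hv
            exacts [haE i, hPE i v hv]
          · rw [card_biUnion, sum_congr rfl (g := fun _ => 1 + (2 * (h + 1) ^ 2 + 1) * (2 * c))]
            · rw [sum_const, card_univ, Fintype.card_fin, hcE, smul_eq_mul]
              apply le_of_eq; ring
            · intro i _
              rw [List.toFinset_card_of_nodup (hnodup i), List.length_cons, (hP i).1, hms, add_comm]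
            · intro i _ j _ hij
              refine Finset.disjoint_left.2 fun v hv hv' => ?_
              exact hdis i j hij (List.mem_toFinset.1 hv) (List.mem_toFinset.1 hv')
        rintro ⟨v, hv⟩
        have hv' : v ∈ used r E := hv
        rw [← hcov] at hv'
        obtain ⟨i, -, hi⟩ := mem_biUnion.1 hv'
        exact ⟨eA i, (hmem _ _).2 (by simpa using hi)⟩
  · set W : Set V := ((used r E' : Set V) \ used r E) ∪ A ∪ B with hW
    have haW : ∀ i, a i ∈ W := fun i => Or.inl (Or.inr ⟨i, rfl⟩)
    have hbW : ∀ i, b i ∈ W := fun i => Or.inr ⟨i, rfl⟩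
    have hIW : ∀ i, ∀ v ∈ I i, v ∈ W := fun i v hv => by
      refine Or.inl (Or.inl ⟨?_, ?_⟩)
      · rw [f4, mem_coe]
        exact mem_union_right _ (mem_biUnion.2 ⟨i, mem_univ i, List.mem_toFinset.2 hv⟩)
      · exact fun h => (f1 i (mem_univ i)).2.2.2 v hv h
    have hw : ∀ i, ∃ p : (G.induce W).Walk ⟨a i, haW i⟩ ⟨b i, hbW i⟩,
        p.support.map Subtype.val = a i :: (I i ++ [b i]) := by
      intro i
      refine exists_walk_induce _ _ _ (f1 i (mem_univ i)).2.2.1 ?_ (by simp)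
      intro v hv
      rw [List.mem_append, List.mem_singleton] at hv
      rcases hv with hv | rfl
      exacts [hIW i v hv, hbW i]
    choose p hp using hw
    have hmem : ∀ i (v : W), v ∈ (p i).support ↔ (v : V) = a i ∨ (v : V) ∈ I i ∨ (v : V) = b i := by
      intro i v
      rw [← List.mem_map_of_injective Subtype.val_injective, hp i]
      simp
    have haI : ∀ i j, a i ∉ I j := fun i j hij => (f1 j (mem_univ j)).2.2.2 _ hij (haE i)
    have hbI : ∀ i j, b i ∉ I j := fun i j hij => (f1 j (mem_univ j)).2.2.2 _ hij (n6 i)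
    refine ⟨⟨_, _, p, ?_, ?_⟩, ?_, ?_, ?_⟩
    · intro i
      rw [SimpleGraph.Walk.isPath_def]
      refine List.Nodup.of_map Subtype.val ?_
      rw [hp, List.nodup_cons, List.nodup_append']
      refine ⟨?_, (f1 i (mem_univ i)).2.1, by simp, by simpa using hbI i i⟩
      rw [List.mem_append, List.mem_singleton, not_or]
      exact ⟨haI i i, hab i i⟩
    · intro i j hij v hv hv'
      rw [hmem] at hv hv'
      rcases hv with hv | hv | hv <;> rcases hv' with hv' | hv' | hv'
      · exact hij (hainj (hv.symm.trans hv'))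
      · exact haI _ _ (hv ▸ hv')
      · exact hab _ _ (hv.symm.trans hv')
      · exact haI _ _ (hv' ▸ hv)
      · exact f2 i (mem_univ i) j (mem_univ j) hij hv hv'
      · exact hbI _ _ (hv' ▸ hv)
      · exact hab _ _ (hv'.symm.trans hv)
      · exact hbI _ _ (hv ▸ hv')
      · exact hij (n5 (hv.symm.trans hv'))
    · rintro ⟨v, (⟨hv, hv'⟩ | ⟨i, hi⟩) | ⟨i, hi⟩⟩
      · rw [mem_coe] at hv hv'
        rw [f4, mem_union, mem_biUnion] at hv
        obtain ⟨i, -, hi⟩ := hv.resolve_left hv'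
        exact ⟨i, (hmem _ _).2 (Or.inr (Or.inl (List.mem_toFinset.1 hi)))⟩
      · exact ⟨i, (hmem _ _).2 (Or.inl hi.symm)⟩
      · exact ⟨i, (hmem _ _).2 (Or.inr (Or.inr hi.symm))⟩
    · intro i
      have := congrArg List.length (hp i)
      rw [List.length_map] at this
      rw [LinearForest.size, this]
      simp only [List.length_cons, List.length_append, (f1 i (mem_univ i)).1, List.length_nil]
      omega
    · rintro v ⟨i, rfl | rfl⟩
      · exact Or.inl ⟨i, rfl⟩
      · exact Or.inr ⟨i, rfl⟩

end ExpanderPartition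

namespace ExpanderPartition

open Finset
open scoped Classical

variable {V : Type*} [Fintype V] {G : SimpleGraph V} {D m : ℕ} {r : V} {C : ℝ}

/-! ### Expanders -/

lemma IsExpander.isJoined (hG : IsExpander G C) (hm : (Fintype.card V : ℝ) / (2 * C) ≤ m) :
    IsJoined G m := by
  intro S T hST hS hT
  have := hG.2.2 (S : Set V) (T : Set V) (by exact_mod_cast hST)
  simp only [Nat.card_eq_fintype_card, Set.ncard_coe_finset] at this
  exact_mod_cast this (hm.trans (by exact_mod_cast hS)) (hm.trans (by exact_mod_cast hT))

/-- The root is the only used vertex, which costs one neighbour and explains `D + 1 ≤ C`. Sets too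
large for the first expander condition have enough neighbours by joinedness. -/
lemma IsExpander.isExtendable_empty (hG : IsExpander G C)
    (hD : (D : ℝ) + 1 ≤ C)
    (hroom : 2 * m * D + 4 * m < Fintype.card V) (r : V) : IsExtendable G D m r ∅ := by
  refine ⟨by simp, by simp, by simp, by simp, ?_⟩
  intro S hS
  rcases S.eq_empty_or_nonempty with rfl | hne
  · simp
  have hpos : 1 ≤ S.card := hne.card_pos
  have h1 : (nbhd G S).card ≤ (nbhd G S \ used r ∅).card + 1 := by
    have := card_le_card_sdiff_add_card (s := nbhd G S) (t := used r ∅)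
    simpa [used] using this
  suffices D * S.card + 1 ≤ (nbhd G S).card by omega
  by_cases hlt : (S.card : ℝ) < (Fintype.card V : ℝ) / (2 * C)
  · have h2 := hG.2.1 (S : Set V) (by simpa [Nat.card_eq_fintype_card] using hlt)
    have h3 : (outerNeighbors G (S : Set V)).ncard ≤ (nbhd G S).card := by
      rw [← Set.ncard_coe_finset]
      refine Set.ncard_le_ncard ?_ (Set.toFinite _)
      rintro v ⟨-, s, hs, hsv⟩
      exact mem_coe.2 (mem_nbhd.2 ⟨s, hs, hsv⟩)
    rw [Set.ncard_coe_finset] at h2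
    have h4 : ((D * S.card + 1 : ℕ) : ℝ) ≤ (nbhd G S).card := by
      have e1 : (1 : ℝ) ≤ S.card := by exact_mod_cast hpos
      have e2 : ((outerNeighbors G (S : Set V)).ncard : ℝ) ≤ (nbhd G S).card := by exact_mod_cast h3
      push_cast
      nlinarith
    exact_mod_cast h4
  · have h2 : ((Fintype.card V : ℝ) / (2 * C)) ≤ S.card := not_lt.1 hlt
    have h3 := (hG.isJoined (m := S.card) h2).card_le_nbhd (S := S) le_rfl
    have h4 : D * S.card ≤ D * (2 * m) := Nat.mul_le_mul_left _ hS
    have h5 : D * (2 * m) = 2 * m * D := by ring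
    omega

/-- A set of vertices containing all vertices that are not used by an extendable forest induces
an expander. -/
lemma IsExpander.induce (hG : IsExpander G C) (hC : (10 : ℝ) ^ 15 < C)
    (hm : (Fintype.card V : ℝ) / (2 * C) ≤ m) (hm' : (m : ℝ) ≤ Fintype.card V / C)
    (hD : C / 100 + 12 ≤ D) (hn : 6 ≤ Fintype.card V) {E : Finset (V × V)}
    (hE : IsExtendable G D m r E) (hod : ∀ v, outdeg E v ≤ 11)
    (hc : 2 * (used r E).card ≤ Fintype.card V) {W : Set V} (hW : ∀ v ∉ used r E, v ∈ W) :
    IsExpander (G.induce W) (C / 100) := by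
  have hC0 : 0 < C := lt_trans (by norm_num) hC
  set n := Fintype.card V with hndef
  set w := Nat.card W with hw
  have hwW : w = W.toFinset.card := by rw [hw, Nat.card_eq_card_toFinset]
  have hsplit : univ \ W.toFinset ⊆ used r E := by
    intro v hv
    by_contra hv'
    simp only [mem_sdiff, mem_univ, true_and, Set.mem_toFinset] at hv
    exact hv (hW v hv')
  have hcs : (univ \ W.toFinset).card + w = n := by
    rw [hwW, card_sdiff_add_card_eq_card (subset_univ _), card_univ]
  have hle := card_le_card hsplit
  have hwn : n ≤ 2 * w := by omega
  have hwn' : (n : ℝ) ≤ 2 * w := by exact_mod_cast hwn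
  have hnpos : (6 : ℝ) ≤ n := by exact_mod_cast hn
  -- The threshold `50 * w / C` exceeds `n / (2 * C)`, as `W` has at least half of the vertices; so
  -- the edge condition is inherited from `G`.
  have hdiv : (w : ℝ) / (2 * (C / 100)) = 50 * w / C := by field_simp; ring
  refine ⟨by omega, ?_, ?_⟩
  · intro S hS
    rw [hdiv] at hS
    set S' : Finset V := (Subtype.val '' S).toFinset with hS'
    have hcS : S.ncard = S'.card := by
      rw [hS', ← Set.ncard_eq_toFinset_card', Set.ncard_image_of_injective _ Subtype.val_injective]
    have hmS : ∀ v, v ∈ S' ↔ ∃ hv : v ∈ W, (⟨v, hv⟩ : W) ∈ S := by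
      intro v; simp [hS']
    have hout : (nbhd G S' ∩ W.toFinset) \ S' ⊆
        (Subtype.val '' outerNeighbors (G.induce W) S).toFinset := by
      intro v hv
      rw [mem_sdiff, mem_inter, mem_nbhd, Set.mem_toFinset] at hv
      obtain ⟨⟨⟨s, hs, hsv⟩, hvW⟩, hvS⟩ := hv
      obtain ⟨hsW, hsS⟩ := (hmS s).1 hs
      rw [Set.mem_toFinset]
      exact ⟨⟨v, hvW⟩, ⟨fun h => hvS ((hmS v).2 ⟨hvW, h⟩), ⟨s, hsW⟩, hsS, by simpa using hsv⟩, rfl⟩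
    have hcO : (outerNeighbors (G.induce W) S).ncard =
        (Subtype.val '' outerNeighbors (G.induce W) S).toFinset.card := by
      rw [← Set.ncard_eq_toFinset_card', Set.ncard_image_of_injective _ Subtype.val_injective]
    have hge : (nbhd G S' ∩ W.toFinset).card ≤ (outerNeighbors (G.induce W) S).ncard + S'.card := by
      rw [hcO]
      exact (card_le_card_sdiff_add_card (t := S')).trans (Nat.add_le_add_right (card_le_card hout) _)
    rw [hcS] at hS ⊢
    by_cases hsmall : S'.card ≤ 2 * m
    · have h1 := hE.expand S' hsmall
      have h2 : nbhd G S' \ used r E ⊆ nbhd G S' ∩ W.toFinset := by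
        intro v hv
        rw [mem_sdiff] at hv
        rw [mem_inter, Set.mem_toFinset]
        exact ⟨hv.1, hW v hv.2⟩
      have h3 := card_le_card h2
      have h4 : ∑ v ∈ S', outdeg E v ≤ S'.card * 11 := by
        rw [← smul_eq_mul]; exact sum_le_card_nsmul _ _ _ fun v _ => hod v
      -- The 12 counts, per vertex of `S'`, up to 11 children and the vertex itself, since `nbhd`
      -- may meet `S'`.
      have h5 : D * S'.card ≤ (outerNeighbors (G.induce W) S).ncard + 12 * S'.card := by omega
      have h6 : (D : ℝ) * S'.card ≤ (outerNeighbors (G.induce W) S).ncard + 12 * S'.card := by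
        exact_mod_cast h5
      have h7 : (0 : ℝ) ≤ S'.card := Nat.cast_nonneg _
      nlinarith
    -- A set of more than `2 * m` vertices reaches all but `2 * m` vertices of `G`, hence nearly all
    -- of `W`, while `C / 100 * |S'| < w / 2`.
    · have h1 := (hG.isJoined hm).card_le_nbhd (S := S') (by omega)
      have h2 : (nbhd G S').card ≤ (nbhd G S' ∩ W.toFinset).card + (univ \ W.toFinset).card := by
        rw [← card_inter_add_card_sdiff (nbhd G S') W.toFinset]
        exact Nat.add_le_add_left (card_le_card (sdiff_subset_sdiff (subset_univ _) subset_rfl)) _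
      have h3 : w ≤ (outerNeighbors (G.induce W) S).ncard + S'.card + 2 * m := by omega
      have h4 : (w : ℝ) ≤ (outerNeighbors (G.induce W) S).ncard + S'.card + 2 * m := by
        exact_mod_cast h3
      rw [lt_div_iff₀ hC0] at hS
      rw [le_div_iff₀ hC0] at hm'
      have h5 : (10 : ℝ) ^ 15 * S'.card ≤ C * S'.card :=
        mul_le_mul_of_nonneg_right hC.le (Nat.cast_nonneg _)
      have h6 : (10 : ℝ) ^ 15 * m ≤ C * m := mul_le_mul_of_nonneg_right hC.le (Nat.cast_nonneg _)
      linarith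
  · intro S T hST hS hT
    rw [hdiv] at hS hT
    have hb : (Nat.card V : ℝ) / (2 * C) ≤ 50 * w / C := by
      rw [Nat.card_eq_fintype_card, div_le_div_iff₀ (by positivity) hC0]
      nlinarith
    obtain ⟨s, ⟨s', hs', rfl⟩, t, ⟨t', ht', rfl⟩, hst⟩ := hG.2.2 (Subtype.val '' S) (Subtype.val '' T)
      ((Set.disjoint_image_iff Subtype.val_injective).2 hST)
      (by rw [Set.ncard_image_of_injective _ Subtype.val_injective]; exact hb.trans hS)
      (by rw [Set.ncard_image_of_injective _ Subtype.val_injective]; exact hb.trans hT)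
    exact ⟨s', hs', t', ht', by simpa using hst⟩

/-! ### Numerical estimates -/

lemma eventually_clog_le : ∀ᶠ n : ℕ in Filter.atTop,
    (1000 : ℝ) ≤ (n : ℝ) ^ (0.01 : ℝ) ∧ (Nat.clog 2 n : ℝ) ≤ (n : ℝ) ^ (0.01 : ℝ) := by
  have h1 : Filter.Tendsto (fun n : ℕ => (n : ℝ) ^ (0.01 : ℝ)) Filter.atTop Filter.atTop :=
    (tendsto_rpow_atTop (by norm_num)).comp tendsto_natCast_atTop_atTop
  have h2 := (isLittleO_log_rpow_atTop (r := 0.01) (by norm_num)).bound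
    (show (0 : ℝ) < 1 / 4 by norm_num)
  have h3 := tendsto_natCast_atTop_atTop (R := ℝ) |>.eventually h2
  filter_upwards [h1.eventually_ge_atTop 1000, h3, Filter.eventually_ge_atTop 2] with n hn hlog hn2
  refine ⟨hn, ?_⟩
  have hn2' : (2 : ℝ) ≤ n := by exact_mod_cast hn2
  rw [Real.norm_of_nonneg (Real.log_nonneg (by linarith)), Real.norm_of_nonneg (by positivity)]
    at hlog
  have h4 : 2 ^ (Nat.clog 2 n).pred < n := Nat.pow_pred_clog_lt_self (by norm_num) (by omega)
  have h5 : ((Nat.clog 2 n).pred : ℝ) * Real.log 2 ≤ Real.log n := by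
    rw [← Real.log_pow]
    exact Real.log_le_log (by positivity) (by exact_mod_cast h4.le)
  have h6 : (Nat.clog 2 n : ℝ) ≤ (Nat.clog 2 n).pred + 1 := by
    have : Nat.clog 2 n ≤ (Nat.clog 2 n).pred + 1 := by rw [Nat.pred_eq_sub_one]; omega
    exact_mod_cast this
  have h7 := Real.log_two_gt_d9
  have h8 : (0 : ℝ) ≤ (Nat.clog 2 n).pred := Nat.cast_nonneg _
  nlinarith

lemma IsRounding.le_add_one {x : ℝ} {k : ℕ} (hx : 0 ≤ x) (h : IsRounding x k) :
    (k : ℝ) ≤ x + 1 := by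
  rcases h with rfl | rfl
  · exact (Nat.floor_le hx).trans (by linarith)
  · exact (Nat.ceil_lt_add_one hx).le

lemma IsRounding.sub_one_le {x : ℝ} {k : ℕ} (h : IsRounding x k) : x - 1 ≤ k := by
  rcases h with rfl | rfl
  · exact (Nat.sub_one_lt_floor x).le
  · exact (by linarith : x - 1 ≤ x).trans (Nat.le_ceil x)

/-- The sizes of the linking structure and of the paths. -/
lemma size_estimate {n N k h c : ℕ} {t : ℝ} (ht : 1000 ≤ t) (hn : (n : ℝ) = t ^ 100)
    (hN : IsRounding (t ^ 90) N) (hk : IsRounding (t ^ 10 / 5) k) (hh : (h : ℝ) ≤ t)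
    (hc : (c : ℝ) ≤ t) :
    2 ≤ N ∧ N ≤ n ∧ 2 * h + 2 ≤ k ∧
      N + N * (2 * (h + 1) ^ 2 + 1) * (2 * c) + N * (k - 2) ≤ n / 3 := by
  have ht0 : 0 ≤ t := by linarith
  have hN1 := hN.le_add_one (by positivity)
  have hN2 := hN.sub_one_le
  have hk1 := hk.le_add_one (by positivity)
  have hk2 := hk.sub_one_le
  have p10 : 10 ^ 27 * t ≤ t ^ 10 := by
    have : (1000 : ℝ) ^ 9 ≤ t ^ 9 := pow_le_pow_left₀ (by norm_num) ht 9
    calc 10 ^ 27 * t = 1000 ^ 9 * t := by norm_num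
      _ ≤ t ^ 9 * t := by gcongr
      _ = t ^ 10 := by ring
  have p90 : 1000 * t ^ 10 ≤ t ^ 90 := by
    have : (1000 : ℝ) ≤ t ^ 80 := ht.trans (le_self_pow₀ (by linarith) (by norm_num))
    calc 1000 * t ^ 10 ≤ t ^ 80 * t ^ 10 := by gcongr
      _ = t ^ 90 := by ring
  have p93 : 1000000 * t ^ 93 ≤ t ^ 100 := by
    have : (1000 : ℝ) ^ 7 ≤ t ^ 7 := pow_le_pow_left₀ (by norm_num) ht 7
    calc 1000000 * t ^ 93 ≤ 1000 ^ 7 * t ^ 93 := by gcongr; norm_num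
      _ ≤ t ^ 7 * t ^ 93 := by gcongr
      _ = t ^ 100 := by ring
  have p93' : t ^ 90 ≤ t ^ 93 := pow_le_pow_right₀ (by linarith) (by norm_num)
  have p100 : 1000 * t ^ 90 ≤ t ^ 100 := by linarith
  have hN2' : 2 ≤ N := by
    have : (2 : ℝ) ≤ N := by linarith
    exact_mod_cast this
  have hkh : 2 * h + 2 ≤ k := by
    have : ((2 * h + 2 : ℕ) : ℝ) ≤ k := by push_cast; linarith
    exact_mod_cast this
  refine ⟨hN2', ?_, hkh, ?_⟩
  · have : (N : ℝ) ≤ n := by rw [hn]; linarith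
    exact_mod_cast this
  · rw [Nat.le_div_iff_mul_le (by norm_num)]
    have hk3 : ((k - 2 : ℕ) : ℝ) ≤ t ^ 10 / 5 := by
      rw [Nat.cast_sub (by omega)]; push_cast; linarith
    have hN3 : (N : ℝ) ≤ 2 * t ^ 90 := by linarith
    have hh0 : (0 : ℝ) ≤ h := Nat.cast_nonneg _
    have hg : (2 * ((h : ℝ) + 1) ^ 2 + 1) ≤ 9 * t ^ 2 := by nlinarith
    -- With `t = n ^ 0.01` bounding both logarithms, the network has order `t ^ 93`, negligible
    -- against `n = t ^ 100`; the connecting paths in `e2` account for about `n / 5`.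
    have e1 : (N : ℝ) * (2 * ((h : ℝ) + 1) ^ 2 + 1) * (2 * c) ≤ 36 * t ^ 93 := by
      calc (N : ℝ) * (2 * ((h : ℝ) + 1) ^ 2 + 1) * (2 * c)
          ≤ (2 * t ^ 90) * (9 * t ^ 2) * (2 * t) := by gcongr
        _ = 36 * t ^ 93 := by ring
    have e2 : (N : ℝ) * ((k - 2 : ℕ) : ℝ) ≤ t ^ 100 / 5 + t ^ 10 / 5 := by
      calc (N : ℝ) * ((k - 2 : ℕ) : ℝ) ≤ (t ^ 90 + 1) * (t ^ 10 / 5) := by gcongr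
        _ = t ^ 100 / 5 + t ^ 10 / 5 := by ring
    have : (((N + N * (2 * (h + 1) ^ 2 + 1) * (2 * c) + N * (k - 2)) * 3 : ℕ) : ℝ) ≤ n := by
      rw [hn]; push_cast
      linarith
    exact_mod_cast this

lemma two_pow_clog_le {m : ℕ} (hm : 1 ≤ m) : 2 ^ Nat.clog 2 m ≤ 2 * m := by
  rcases hm.eq_or_lt with rfl | hm
  · simp
  · have h1 := Nat.pow_pred_clog_lt_self (b := 2) (by norm_num) hm
    have h2 := Nat.clog_pos (b := 2) (by norm_num) hm
    have h3 : Nat.clog 2 m = (Nat.clog 2 m).pred + 1 := by rw [Nat.pred_eq_sub_one]; omega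
    rw [h3, pow_succ]; omega

/-- Up to rounding, `2 * m * D` is at most `n / 50` and the remaining terms are `O(n / C)`, so a
forest may occupy a third of the vertices. -/
lemma room_estimate {n m : ℕ} (hC : (10 : ℝ) ^ 15 < C) (hn : 1000 * C ≤ n)
    (hm : m = ⌈(n : ℝ) / (2 * C)⌉₊) :
    n / 3 + 2 ^ (Nat.clog 2 m + 2) + 2 * m * ⌊C / 50⌋₊ + 2 * m < n ∧ (m : ℝ) ≤ n / C ∧ 1 ≤ m := by
  have hC0 : 0 < C := lt_trans (by norm_num) hC
  have hq : 1000 ≤ (n : ℝ) / C := by rwa [le_div_iff₀ hC0]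
  have hq' : (n : ℝ) / (2 * C) = n / C / 2 := by field_simp
  have hqn : (n : ℝ) / C * C = n := by field_simp
  have hm1 : (m : ℝ) ≤ n / C / 2 + 1 := by
    rw [hm, ← hq']; exact (Nat.ceil_lt_add_one (by positivity)).le
  have hm0 : 1 ≤ m := by
    rw [hm, Nat.one_le_ceil_iff, hq']; linarith
  have hD : ((⌊C / 50⌋₊ : ℕ) : ℝ) ≤ C / 50 := Nat.floor_le (by positivity)
  have hp : ((2 ^ (Nat.clog 2 m + 2) : ℕ) : ℝ) ≤ 8 * m := by
    have := two_pow_clog_le hm0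
    have : 2 ^ (Nat.clog 2 m + 2) ≤ 8 * m := by rw [pow_add]; omega
    exact_mod_cast this
  have h3 : ((n / 3 : ℕ) : ℝ) ≤ n / 3 := Nat.cast_div_le
  refine ⟨?_, by linarith, hm0⟩
  have hmD : (m : ℝ) * (⌊C / 50⌋₊ : ℕ) ≤ (n / C / 2 + 1) * (C / 50) := by gcongr
  have hmD' : (n / C / 2 + 1) * (C / 50) = (n : ℝ) / 100 + C / 50 := by field_simp; ring
  have hnC : (n : ℝ) / C * 1000 ≤ n := by nlinarith
  have : ((n / 3 + 2 ^ (Nat.clog 2 m + 2) + 2 * m * ⌊C / 50⌋₊ + 2 * m : ℕ) : ℝ) < n := by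
    push_cast at hp ⊢
    nlinarith
  exact_mod_cast this

end ExpanderPartition

/-! ### Choice of parameters and assembly -/

theorem mainTheorem8 (C : ℝ) (hC : (10 : ℝ) ^ 15 < C) :
    ∃ n₀ : ℕ, ∀ n : ℕ, n₀ ≤ n →
      ∀ N k : ℕ, ExpanderPartition.IsRounding ((n : ℝ) ^ (0.9 : ℝ)) N →
        ExpanderPartition.IsRounding ((n : ℝ) ^ (0.1 : ℝ) / 5) k →
      ∀ (V : Type*) [Fintype V] (G : SimpleGraph V), Fintype.card V = n →
        ExpanderPartition.IsExpander G C →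
        ∃ X Y Z A B : Set V,
          X ∪ Y ∪ Z = Set.univ ∧ Disjoint X Y ∧ Disjoint X Z ∧ Disjoint Y Z ∧
          A ⊆ X ∧ B ⊆ X ∧ Disjoint A B ∧
          (ExpanderPartition.IsLinkingStructure (G.induce X)
              ((↑) ⁻¹' A : Set X) ((↑) ⁻¹' B : Set X) ∧
            A.ncard = N ∧ B.ncard = N) ∧
          (∃ F : ExpanderPartition.LinearForest (G.induce (Y ∪ A ∪ B)) N,
            F.IsSpanning ∧ (∀ i, F.size i = k) ∧
            ∀ v ∈ F.ends, (v : V) ∈ A ∪ B) ∧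
          ExpanderPartition.IsExpander (G.induce Z) (C / 100) ∧
          ExpanderPartition.IsExpander (G.induce (Z ∪ Y ∪ A ∪ B)) (C / 100) := by
  open ExpanderPartition in
  obtain ⟨n₁, hn₁⟩ := Filter.eventually_atTop.1 eventually_clog_le
  have hC0 : 0 < C := lt_trans (by norm_num) hC
  refine ⟨max n₁ ⌈1000 * C⌉₊, ?_⟩
  intro n hn N k hN hk V _ G hV hG
  obtain ⟨ht, hlog⟩ := hn₁ n ((le_max_left _ _).trans hn)
  have hnC : 1000 * C ≤ n := Nat.ceil_le.1 ((le_max_right _ _).trans hn)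
  obtain ⟨m, hm⟩ : ∃ m, m = ⌈(n : ℝ) / (2 * C)⌉₊ := ⟨_, rfl⟩
  obtain ⟨hroom, hm', hm1⟩ := room_estimate hC hnC hm
  have hmle : (n : ℝ) / (2 * C) ≤ m := hm ▸ Nat.le_ceil _
  have hmn : m ≤ n := by
    have := Nat.one_le_two_pow (n := Nat.clog 2 m + 2)
    omega
  have hpow : ∀ j : ℕ, ((n : ℝ) ^ (0.01 : ℝ)) ^ j = (n : ℝ) ^ (0.01 * j : ℝ) := fun j => by
    rw [← Real.rpow_natCast, ← Real.rpow_mul (Nat.cast_nonneg n)]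
  have hclog : ∀ j ≤ n, (Nat.clog 2 j : ℝ) ≤ (n : ℝ) ^ (0.01 : ℝ) := fun j hj =>
    le_trans (by exact_mod_cast Nat.clog_mono_right 2 hj) hlog
  have hN' : IsRounding (((n : ℝ) ^ (0.01 : ℝ)) ^ 90) N := by
    rw [hpow]; convert hN using 2; norm_num
  have hk' : IsRounding (((n : ℝ) ^ (0.01 : ℝ)) ^ 10 / 5) k := by
    rw [hpow]; convert hk using 3; norm_num
  have hn' : (n : ℝ) = ((n : ℝ) ^ (0.01 : ℝ)) ^ 100 := by
    rw [hpow]; norm_num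
  -- A preliminary use with `h = c = 0`: `N ≤ n` is needed to bound `Nat.clog 2 N` before the
  -- estimate can be applied with the true parameters.
  have hNn : N ≤ n := (size_estimate (h := 0) (c := 0) ht hn' hN' hk' (by simp; positivity)
    (by simp; positivity)).2.1
  obtain ⟨hN2, -, hkh, hK⟩ := size_estimate ht hn' hN' hk' (hclog m hmn) (hclog N hNn)
  have hD1 : C / 50 - 1 ≤ (⌊C / 50⌋₊ : ℕ) := (Nat.sub_one_lt_floor _).le
  have hD2 : ((⌊C / 50⌋₊ : ℕ) : ℝ) ≤ C / 50 := Nat.floor_le (by positivity)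
  generalize hD : ⌊C / 50⌋₊ = D at hroom hD1 hD2
  subst hV
  have hne : Nonempty V := Fintype.card_pos_iff.1 (by omega)
  have hhost : IsHost G D m (Nat.clog 2 m) (Fintype.card V / 3) := by
    refine ⟨hG.isJoined hmle, Nat.le_pow_clog (by norm_num) m, hroom, ?_⟩
    have : (100 : ℝ) ≤ D := by linarith
    exact_mod_cast this
  have hpow2 : 4 * m ≤ 2 ^ (Nat.clog 2 m + 2) := by
    have := hhost.le_pow
    rw [pow_add]; omega
  have h0 : IsExtendable G D m hne.some ∅ :=
    hG.isExtendable_empty (by linarith) (by omega) _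
  obtain ⟨E, E', A, B, e1, e2, e3, e4, e5, e6, e7, e8, e9, e10, e11, e12, hF⟩ :=
    exists_linking_forest hhost h0 (by omega) (Nat.clog_pos (by norm_num) hN2)
      (Nat.le_pow_clog (by norm_num) N) hkh hK
  set X : Set V := (used hne.some E : Set V) with hX
  set W : Set V := (used hne.some E' : Set V) with hW
  have hXW : X ⊆ W := by exact_mod_cast e5
  have hcE := Finset.card_le_card e5
  have h6 : 6 ≤ Fintype.card V := by
    have : (6 : ℝ) ≤ Fintype.card V := by linarith
    exact_mod_cast this
  refine ⟨X, W \ X, Wᶜ, A, B, ?_, Set.disjoint_sdiff_right, ?_, ?_, e7, e8, e9, ⟨e10, e11, e12⟩,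
    hF, ?_, ?_⟩
  · rw [Set.union_sdiff_cancel hXW, Set.union_compl_self]
  · exact Set.disjoint_compl_right_iff_subset.2 hXW
  · exact Set.disjoint_compl_right_iff_subset.2 Set.sdiff_subset
  -- Both expanders come from the same lemma: `Z` is the set of vertices unused by `E'`, and `Z ∪ Y
  -- ∪ A ∪ B` contains all vertices unused by the smaller forest `E`.
  · exact hG.induce hC hmle hm' (by linarith) h6 e2 e4 (by omega) fun v hv => hv
  · refine hG.induce hC hmle hm' (by linarith) h6 e1 (fun v => (e3 v).trans (by omega)) (by omega) ?_
    intro v hv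
    by_cases hvW : v ∈ W
    · exact Or.inl (Or.inl (Or.inr ⟨hvW, hv⟩))
    · exact Or.inl (Or.inl (Or.inl hvW))
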